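/- **Model.** A network has $M$ sensor nodes (SNs) $\mathcal I_s$ and finitely many relay nodes (RNs) $\mathcal I_r$; let $\mathcal V=\mathcal I_s\cup\mathcal I_r$. At each time $t=0,1,2,\dots$ there is a deterministic set $\mathcal E(t)\subset\mathcal V\times\mathcal V$ of directed links, without self-loops and without links between two RNs; $(j,i)\in\mathcal E(t)$ is a link from $j$ to $i$. Let $\mathcal N_i^s(t)$ and $\mathcal N_i^r(t)$ be the sets of SNs and of RNs $j$ with $(j,i)\in\mathcal E(t)$, and $\mathcal N_i(t)=\mathcal N_i^s(t)\cup\mathcal N_i^r(t)$. Let $\chi_i(t)\in\{0,1\}$ indicate whether SN $i$ has a measurement $y_i(t)=\theta+w_i(t)$ of the unknown $\theta\in\mathbb R$ at time $t$. Let $\alpha_i(t)>0$ ($i\in\mathcal V$), $a(t)>0$ and $b_i(t)\in\mathbb R$ ($i\in\mathcal I_s$) be deterministic, let $h_{ij}(t)$ be the real random fading coefficient and $v_{ij}(t)$ the random receiver noise of the link from $j$ to $i$. Put $\boldsymbol\Delta(t)=\mathrm{diag}(\chi_1(t),\dots,\chi_M(t))$, $\mathbf L(t)=[l_{ij}(t)]_{M\times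 M}$ with, for $j\ne i$, $$l_{ij}(t)=-\alpha_j(t)\Bigl[\mathbb 1_{\{j\in\mathcal N_i^s(t)\}}h_{ij}(t)+\sum_{k\in\mathcal N_i^r(t):\,j\in\mathcal N_k^s(t)}\alpha_k(t)h_{ik}(t)h_{kj}(t)\Bigr],\qquad l_{ii}(t)=-\sum_{j\ne i}l_{ij}(t),$$ $\boldsymbol\Gamma(t)=\mathrm{diag}(\gamma_1(t),\dots,\gamma_M(t))$ with $$\gamma_i(t)=\sum_{j\in\mathcal N_i^s(t)}\alpha_j(t)h_{ij}(t)+\sum_{j\in\mathcal N_i^r(t)}\alpha_j(t)h_{ij}(t)\sum_{k\in\mathcal N_j^s(t)}\alpha_k(t)h_{jk}(t)-b_i(t),$$ $v_i(t)=\sum_{j\in\mathcal N_i(t)}v_{ij}(t)+\sum_{j\in\mathcal N_i^r(t)}\alpha_j(t)h_{ij}(t)\sum_{k\in\mathcal N_j^s(t)}v_{jk}(t)$, and $\boldsymbol\Phi=\boldsymbol\Delta+\mathbf L-\boldsymbol\Gamma$. The estimates $\mathbf x(t)\in\mathbb R^M$ of the SNs evolve by $$\mathbf x(t+1)=(\mathbf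 I-a(t)\boldsymbol\Phi(t))\mathbf x(t)+a(t)\boldsymbol\Delta(t)\mathbf y(t)+a(t)\mathbf v(t),$$ where $\mathbf y(t)=[y_i(t)]_i$, $\mathbf v(t)=[v_i(t)]_i$, and $\mathbf x(0)$ is deterministic or, more generally, square integrable and independent of all $w$, $v$ and $h$. **Assumptions.** 1. There is an integer $B>0$ such that for every $k\ge 0$ the matrix $\sum_{t=kB}^{(k+1)B-1}\mathbb E\{\mathbf A(t)\}$ is the weighted adjacency matrix of a strongly connected graph on $\mathcal V$, where $\mathbf A(t)$ has the entry $h_{ij}(t)$ at $(i,j)$ if $(j,i)\in\mathcal E(t)$ and $0$ otherwise. 2. There is an integer $T>0$ such that in every $T$ consecutive time steps at least one SN has a measurement. The noise vectors $\mathbf w(t)=[w_i(t)]_i$, $t\ge 0$, are i.i.d. with zero mean and finite variance. 3. $\mathbb E\{h_{ij}(t)\}>0$, and the second moments of the $h_{ij}(t)$ are finite and bounded in $t$; the $h_{ij}(t)$ are independent across transmitters $j$ and time steps $t$. The $v_{ij}(t)$ have zero mean and finite variances bounded in $t$, and are temporally independent. 4. The measurement noises, the receiver noises and the fading coefficients are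 mutually independent: together with 2 and 3, the groups $\{w_i(t)\}_i$, $\{v_{ij}(t)\}_{i,j}$ ($t\ge 0$) and $\{h_{ij}(t)\}_i$ ($t\ge 0$, $j\in\mathcal V$) are mutually independent. **Theorem.** Let Assumptions 1–4 hold, and let the $\alpha_i(t)$ and the $b_i(t)$ be bounded. Assume that $\mathbb E\{\boldsymbol\Gamma(t)\}=\mathbf 0$ for all $t$; that there is $0<\underline c<1$ with $\underline c\le a(t+1)/a(t)\le 1$ for large $t$, and $\lim_{t\to\infty}a(t)=0$; that for every $\nu>0$ there is $\kappa>0$ such that for all large $t$ there is an integer $T(t,\nu)>0$ with $\kappa\nu\le\sum_{s=t}^{t+T(t,\nu)}a(s)\le\nu$; and that $\sum_{t=0}^\infty a(t)^2<\infty$. Let $\tau=\max\{T,B\}$, $t_k=k\tau$, $\bar{\mathbf L}(s)=\mathbb E\{\mathbf L(s)\}$ and $$\mathbf J_k=\sum_{s=t_k}^{t_{k+1}-1}a(s)\bigl(2\boldsymbol\Delta(s)+\bar{\mathbf L}(s)+\bar{\mathbf L}(s)^T\bigr),$$ and assume that there is $c^*>0$ such that $\lambda_{\min}(\mathbf J_k)\ge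 c^*a(t_k)$ for all $k\ge 0$. Then $\mathbb E\{\|\mathbf x(t)-\theta\mathbf 1\|_2^2\}$ is finite for every $t$ and $$\lim_{t\to\infty}\mathbb E\{\|\mathbf x(t)-\theta\mathbf 1\|_2^2\}=0.$$ -/

import Mathlib

open MeasureTheory ProbabilityTheory Filter Topology

/-- Nodes of the network: `Sum.inl i` is sensor node (SN) `i`, `Sum.inr p` is relay node (RN) `p`. -/
abbrev Node (M R : ℕ) : Type := Fin M ⊕ Fin R

/-- The data of the relay-assisted estimation algorithm: a time-varying directed graph without
self-loops and without links between relay nodes (one-hop relays), deterministic weights, and the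
random noises, fading coefficients and initial estimate. -/
structure RelaySystem (M R : ℕ) (Ω : Type*) [MeasurableSpace Ω] where
  /-- `(j, i) ∈ edges t` is the communication link from node `j` to node `i` at time `t`. -/
  edges : ℕ → Set (Node M R × Node M R)
  no_self_loop : ∀ t i, (i, i) ∉ edges t
  no_relay_relay : ∀ t (p q : Fin R), (Sum.inr p, Sum.inr q) ∉ edges t
  /-- the sensor nodes that have a measurement at time `t` -/
  measuring : ℕ → Set (Fin M)
  /-- the unknown parameter -/
  θ : ℝ
  /-- amplification factors -/
  α : ℕ → Node M R → ℝ
  α_pos : ∀ t i, 0 < α t i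
  /-- innovation weights -/
  a : ℕ → ℝ
  a_pos : ∀ t, 0 < a t
  b : ℕ → Fin M → ℝ
  /-- measurement noise `w_i(t)` -/
  w : ℕ → Fin M → Ω → ℝ
  measurable_w : ∀ t i, Measurable (w t i)
  /-- receiver noise `v_ij(t)` at node `i` in the transmission from node `j` -/
  v : ℕ → Node M R → Node M R → Ω → ℝ
  measurable_v : ∀ t i j, Measurable (v t i j)
  /-- fading coefficient `h_ij(t)` of the link from node `j` to node `i` -/
  h : ℕ → Node M R → Node M R → Ω → ℝ
  measurable_h : ∀ t i j, Measurable (h t i j)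
  /-- initial estimate -/
  x₀ : Ω → Fin M → ℝ
  measurable_x₀ : Measurable x₀

/-- Entrywise expectation of a random matrix. -/
noncomputable def meanMatrix {Ω m n : Type*} [MeasurableSpace Ω] (P : Measure Ω)
    (X : Ω → Matrix m n ℝ) : Matrix m n ℝ :=
  Matrix.of fun i j => ∫ ω, X ω i j ∂P

/-- The smallest eigenvalue of a (symmetric) real matrix. -/
noncomputable def minEigenvalue {n : Type*} [Fintype n] [DecidableEq n] (A : Matrix n n ℝ) : ℝ :=
  sInf (spectrum ℝ A)

/-- The weighted digraph with an edge from `j` to `i` whenever `0 < W i j` is strongly connected. -/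
def StronglyConnected {V : Type*} (W : Matrix V V ℝ) : Prop :=
  ∀ p q : V, Relation.ReflTransGen (fun j i => 0 < W i j) p q

namespace RelaySystem

variable {M R : ℕ} {Ω : Type*} [MeasurableSpace Ω]

open Classical in
/-- The SN neighbours of node `i` at time `t`. -/
noncomputable def nbrS (S : RelaySystem M R Ω) (t : ℕ) (i : Node M R) : Finset (Fin M) :=
  Finset.univ.filter fun j => (Sum.inl j, i) ∈ S.edges t

open Classical in
/-- The RN neighbours of node `i` at time `t`. -/
noncomputable def nbrR (S : RelaySystem M R Ω) (t : ℕ) (i : Node M R) : Finset (Fin R) :=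
  Finset.univ.filter fun p => (Sum.inr p, i) ∈ S.edges t

open Classical in
/-- The adjacency matrix with fading, with entries `a_ij(t) h_ij(t)`. -/
noncomputable def adj (S : RelaySystem M R Ω) (t : ℕ) (ω : Ω) :
    Matrix (Node M R) (Node M R) ℝ :=
  Matrix.of fun i j => if (j, i) ∈ S.edges t then S.h t i j ω else 0

open Classical in
/-- `Δ(t)`, the diagonal matrix of the measurement indicators. -/
noncomputable def Δ (S : RelaySystem M R Ω) (t : ℕ) : Matrix (Fin M) (Fin M) ℝ :=
  Matrix.diagonal fun i => if i ∈ S.measuring t then 1 else 0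

/-- The off-diagonal entries `l_ij(t)`, `j ≠ i`: minus the total gain from SN `j` to SN `i`, directly
and through one relay. -/
noncomputable def lOff (S : RelaySystem M R Ω) (t : ℕ) (ω : Ω) (i j : Fin M) : ℝ :=
  -S.α t (Sum.inl j) *
    ((if j ∈ S.nbrS t (Sum.inl i) then S.h t (Sum.inl i) (Sum.inl j) ω else 0) +
      ∑ k ∈ (S.nbrR t (Sum.inl i)).filter (fun k => j ∈ S.nbrS t (Sum.inr k)),
        S.α t (Sum.inr k) * S.h t (Sum.inl i) (Sum.inr k) ω * S.h t (Sum.inr k) (Sum.inl j) ω)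

/-- The random Laplacian `L(t)`. -/
noncomputable def L (S : RelaySystem M R Ω) (t : ℕ) (ω : Ω) : Matrix (Fin M) (Fin M) ℝ :=
  Matrix.of fun i j =>
    if j = i then -∑ k ∈ Finset.univ.erase i, S.lOff t ω i k else S.lOff t ω i j

/-- The diagonal entries `γ_i(t)`. -/
noncomputable def γ (S : RelaySystem M R Ω) (t : ℕ) (ω : Ω) (i : Fin M) : ℝ :=
  ∑ j ∈ S.nbrS t (Sum.inl i), S.α t (Sum.inl j) * S.h t (Sum.inl i) (Sum.inl j) ω +
    ∑ p ∈ S.nbrR t (Sum.inl i), S.α t (Sum.inr p) * S.h t (Sum.inl i) (Sum.inr p) ω *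
      ∑ k ∈ S.nbrS t (Sum.inr p), S.α t (Sum.inl k) * S.h t (Sum.inr p) (Sum.inl k) ω
    - S.b t i

/-- The random uncertainty matrix `Γ(t)`. -/
noncomputable def Γ (S : RelaySystem M R Ω) (t : ℕ) (ω : Ω) : Matrix (Fin M) (Fin M) ℝ :=
  Matrix.diagonal (S.γ t ω)

/-- `Φ(t) = Δ(t) + L(t) - Γ(t)`. -/
noncomputable def Φ (S : RelaySystem M R Ω) (t : ℕ) (ω : Ω) : Matrix (Fin M) (Fin M) ℝ :=
  S.Δ t + S.L t ω - S.Γ t ω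

/-- The measurements `y_i(t) = θ + w_i(t)`. -/
def y (S : RelaySystem M R Ω) (t : ℕ) (ω : Ω) (i : Fin M) : ℝ :=
  S.θ + S.w t i ω

/-- The total receiver noise `v_i(t)` at SN `i`, including the noise forwarded by its relays. -/
noncomputable def vTot (S : RelaySystem M R Ω) (t : ℕ) (ω : Ω) (i : Fin M) : ℝ :=
  (∑ j ∈ S.nbrS t (Sum.inl i), S.v t (Sum.inl i) (Sum.inl j) ω +
    ∑ p ∈ S.nbrR t (Sum.inl i), S.v t (Sum.inl i) (Sum.inr p) ω) +
  ∑ p ∈ S.nbrR t (Sum.inl i), S.α t (Sum.inr p) * S.h t (Sum.inl i) (Sum.inr p) ω *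
    ∑ k ∈ S.nbrS t (Sum.inr p), S.v t (Sum.inr p) (Sum.inl k) ω

/-- The estimates `x(t)` of the sensor nodes:
`x(t+1) = (I - a(t) Φ(t)) x(t) + a(t) Δ(t) y(t) + a(t) v(t)`. -/
noncomputable def x (S : RelaySystem M R Ω) : ℕ → Ω → Fin M → ℝ
  | 0, ω => S.x₀ ω
  | t + 1, ω =>
      (1 - S.a t • S.Φ t ω).mulVec (S.x t ω) + S.a t • (S.Δ t).mulVec (S.y t ω) +
        S.a t • S.vTot t ω

/-- `L̄(t) = E{L(t)}`. -/
noncomputable def Lbar (S : RelaySystem M R Ω) (P : Measure Ω) (t : ℕ) :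
    Matrix (Fin M) (Fin M) ℝ :=
  meanMatrix P (S.L t)

/-- `J_k = ∑_{s = t_k}^{t_{k+1} - 1} a(s) (2Δ(s) + L̄(s) + L̄(s)ᵀ)`, where `t_k = k τ`. -/
noncomputable def J (S : RelaySystem M R Ω) (P : Measure Ω) (τ k : ℕ) :
    Matrix (Fin M) (Fin M) ℝ :=
  ∑ s ∈ Finset.Ico (k * τ) ((k + 1) * τ),
    S.a s • ((2 : ℝ) • S.Δ s + S.Lbar P s + (S.Lbar P s).transpose)

/-- Joint connectivity on average over the blocks `[kB, (k+1)B)`. -/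
def Assumption1 (S : RelaySystem M R Ω) (P : Measure Ω) (B : ℕ) : Prop :=
  0 < B ∧ ∀ k : ℕ,
    StronglyConnected (∑ t ∈ Finset.Ico (k * B) ((k + 1) * B), meanMatrix P (S.adj t))

/-- Some SN measures at least once in every `T` consecutive steps; the vectors `w(t)` are i.i.d.
with zero mean and finite variance. -/
structure Assumption2 (S : RelaySystem M R Ω) (P : Measure Ω) (T : ℕ) : Prop where
  T_pos : 0 < T
  measures : ∀ t, ∃ s, t ≤ s ∧ s < t + T ∧ (S.measuring s).Nonempty
  indep : iIndepFun (fun (t : ℕ) (ω : Ω) (i : Fin M) => S.w t i ω) P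
  identDistrib : ∀ t, IdentDistrib (fun ω i => S.w t i ω) (fun ω i => S.w 0 i ω) P P
  memLp : ∀ t i, MemLp (S.w t i) 2 P
  mean : ∀ t i, ∫ ω, S.w t i ω ∂P = 0

/-- The fading coefficients have positive means and finite second moments, bounded uniformly in time,
and are independent across transmitters and time steps; the receiver noises have zero mean and finite
variances, bounded uniformly in time, and are temporally independent. -/
structure Assumption3 (S : RelaySystem M R Ω) (P : Measure Ω) : Prop where
  memLp_h : ∀ t i j, MemLp (S.h t i j) 2 P
  mean_h : ∀ t i j, 0 < ∫ ω, S.h t i j ω ∂P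
  bound_h : ∃ C : ℝ, ∀ t i j, ∫ ω, S.h t i j ω ^ 2 ∂P ≤ C
  indep_h : iIndepFun
    (fun (q : ℕ × Node M R) (ω : Ω) (i : Node M R) => S.h q.1 i q.2 ω) P
  memLp_v : ∀ t i j, MemLp (S.v t i j) 2 P
  mean_v : ∀ t i j, ∫ ω, S.v t i j ω ∂P = 0
  bound_v : ∃ C : ℝ, ∀ t i j, ∫ ω, S.v t i j ω ^ 2 ∂P ≤ C
  indep_v : iIndepFun
    (fun (t : ℕ) (ω : Ω) (q : Node M R × Node M R) => S.v t q.1 q.2 ω) P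

/-- Labels of the mutually independent groups of random variables: the initial estimate, the
measurement noises at time `t`, the receiver noises at time `t`, and the fading coefficients of
transmitter `j` at time `t`. -/
inductive Source (M R : ℕ) : Type
  | init : Source M R
  | meas (t : ℕ) : Source M R
  | recv (t : ℕ) : Source M R
  | fading (t : ℕ) (j : Node M R) : Source M R

/-- The σ-algebra generated by a group of random variables. -/
@[reducible]
def sigmaOf (S : RelaySystem M R Ω) : Source M R → MeasurableSpace Ω
  | .init => MeasurableSpace.comap S.x₀ inferInstance
  | .meas t => MeasurableSpace.comap (fun ω (i : Fin M) => S.w t i ω) inferInstance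
  | .recv t =>
      MeasurableSpace.comap (fun ω (q : Node M R × Node M R) => S.v t q.1 q.2 ω) inferInstance
  | .fading t j => MeasurableSpace.comap (fun ω (i : Node M R) => S.h t i j ω) inferInstance

/-- The measurement noises, the receiver noises and the fading coefficients are mutually independent
(and independent of the initial estimate, which is vacuous if that is deterministic). -/
def Assumption4 (S : RelaySystem M R Ω) (P : Measure Ω) : Prop :=
  iIndep S.sigmaOf P

end RelaySystem

/-- `c ≤ a(t+1)/a(t) ≤ 1` for large `t`, for some `0 < c < 1`, and `a(t) → 0`. -/
def SlowDecay (a : ℕ → ℝ) : Prop :=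
  (∃ c : ℝ, 0 < c ∧ c < 1 ∧ ∀ᶠ t in atTop, c ≤ a (t + 1) / a t ∧ a (t + 1) / a t ≤ 1) ∧
    Tendsto a atTop (𝓝 0)

/-- For any `ν > 0` there is `κ > 0` such that for all large `t` there is `T > 0` with
`κ ν ≤ ∑_{s=t}^{t+T} a(s) ≤ ν`. -/
def PersistentSums (a : ℕ → ℝ) : Prop :=
  ∀ ν : ℝ, 0 < ν → ∃ κ : ℝ, 0 < κ ∧ ∀ᶠ t in atTop, ∃ T : ℕ, 0 < T ∧
    κ * ν ≤ ∑ s ∈ Finset.Icc t (t + T), a s ∧ ∑ s ∈ Finset.Icc t (t + T), a s ≤ ν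

/-!
The error `e t = x t - θ 𝟙` satisfies `e (t + 1) = e t + a t • (n t - Φ t (e t))`, where
`n = Δ w + v + θ γ`, because the rows of `L` sum to zero. Both `n t` and `Φ t` are independent of
`e t`, `n t` is centred and `Φ t` has mean `Δ + L̄`, so `V t = 𝔼‖e t‖²` obeys
`V (t + 1) = V t - 2 a(t) 𝔼⟪e t, (Δ + L̄) e t⟫ + O(a(t)² (1 + V t))`. Along a block of `τ` steps the
state in the drift terms may be frozen at the start `t_k` of the block at the cost of
`O(a(t_k)² (1 + V t_k))`. The drift then adds up to `𝔼⟪e t_k, J_k (e t_k)⟫ ≥ c a(t_k) V t_k`, whence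
`V t_{k+1} ≤ (1 - c a(t_k) / 2) V t_k + O(a(t_k)²)` for large `k`. As `∑ a(t_k)` diverges and
`∑ a(t)²` converges, `V t_k → 0`, and `V` changes by only `O(a(t_k) (1 + V t_k))` inside a block.
-/

section RealSequences

theorem exists_tendsto_and_summable_of_le_sub_add {u d q : ℕ → ℝ} (hu : ∀ k, 0 ≤ u k)
    (hd : ∀ k, 0 ≤ d k) (hq : ∀ k, 0 ≤ q k) (hqs : Summable q)
    (h : ∀ k, u (k + 1) ≤ u k - d k + q k) : (∃ l, Tendsto u atTop (𝓝 l)) ∧ Summable d := by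
  let U k := u k + ∑ i ∈ Finset.range k, d i - ∑ i ∈ Finset.range k, q i
  have hU : Antitone U := antitone_nat_of_succ_le fun k => by
    simp only [U, Finset.sum_range_succ]
    linarith [h k]
  have hq_le k : ∑ i ∈ Finset.range k, q i ≤ ∑' i, q i := hqs.sum_le_tsum _ fun i _ => hq i
  have hU_bdd : BddBelow (Set.range U) := by
    refine ⟨-∑' i, q i, ?_⟩
    rintro _ ⟨k, rfl⟩
    linarith [hu k, hq_le k, Finset.sum_nonneg fun i (_ : i ∈ Finset.range k) => hd i]
  have hds : Summable d := by
    refine summable_of_sum_range_le (c := U 0 + ∑' i, q i) hd fun k => ?_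
    linarith [hu k, hq_le k, hU (Nat.zero_le k)]
  refine ⟨⟨_, (((tendsto_atTop_ciInf hU hU_bdd).sub hds.hasSum.tendsto_sum_nat).add
    hqs.hasSum.tendsto_sum_nat).congr fun k => ?_⟩, hds⟩
  simp only [U]
  ring

theorem tendsto_zero_of_le_one_sub_mul_add {u p q : ℕ → ℝ} (hu : ∀ k, 0 ≤ u k)
    (hp : ∀ k, 0 ≤ p k) (hq : ∀ k, 0 ≤ q k) (hps : ¬ Summable p) (hqs : Summable q)
    (h : ∀ᶠ k in atTop, u (k + 1) ≤ (1 - p k) * u k + q k) : Tendsto u atTop (𝓝 0) := by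
  obtain ⟨N, hN⟩ := eventually_atTop.1 h
  obtain ⟨⟨l, hl⟩, hpu⟩ := exists_tendsto_and_summable_of_le_sub_add
    (u := fun k => u (k + N)) (d := fun k => p (k + N) * u (k + N)) (fun k => hu _)
    (fun k => mul_nonneg (hp _) (hu _)) (fun k => hq _) ((summable_nat_add_iff N).2 hqs)
    fun k => by
      rw [add_right_comm]
      linarith [hN (k + N) (Nat.le_add_left N k)]
  rw [tendsto_add_atTop_iff_nat] at hl
  rw [summable_nat_add_iff N (f := fun k => p k * u k)] at hpu
  obtain rfl | hl_pos := (ge_of_tendsto' hl hu).eq_or_lt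
  · exact hl
  refine absurd ?_ hps
  refine (hpu.mul_left (2 / l)).of_norm_bounded_eventually_nat ?_
  filter_upwards [hl.eventually_const_lt (half_lt_self hl_pos)] with k hk
  rw [Real.norm_of_nonneg (hp k), div_mul_eq_mul_div, le_div_iff₀ hl_pos]
  linarith [mul_le_mul_of_nonneg_left hk.le (hp k)]

theorem summable_of_summable_comp_mul_right {f : ℕ → ℝ} (hf : ∀ n, 0 ≤ f n)
    (hf_anti : ∀ᶠ n in atTop, f (n + 1) ≤ f n) {τ : ℕ} (hτ : 0 < τ)
    (hs : Summable fun k => f (k * τ)) : Summable f := by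
  obtain ⟨N, hN⟩ := eventually_atTop.1 hf_anti
  have hg_anti : Antitone fun n => f (n + N * τ) := antitone_nat_of_succ_le fun n => by
    simpa only [add_right_comm] using hN (n + N * τ) (by nlinarith)
  rw [← summable_nat_add_iff (N * τ), ← summable_schlomilch_iff_of_nonneg (C := 1)
    (u := fun k => (k + 1) * τ) (fun n => hf _) (fun m n _ hmn => hg_anti hmn)
    (fun n => by positivity) (fun m n hmn => by simpa [hτ] using hmn) one_ne_zero
    fun n => by simp [← Nat.sub_mul]]
  refine (((summable_nat_add_iff (N + 1)).2 hs).mul_left (τ : ℝ)).congr fun k => ?_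
  rw [show (k + 1) * τ + N * τ = (k + (N + 1)) * τ by ring]
  push_cast
  ring

theorem PersistentSums.not_summable {a : ℕ → ℝ} (h : PersistentSums a) : ¬ Summable a := by
  intro hs
  obtain ⟨κ, hκ, hev⟩ := h 1 one_pos
  obtain ⟨N, hN⟩ := Metric.cauchySeq_iff.1 hs.hasSum.tendsto_sum_nat.cauchySeq κ hκ
  obtain ⟨t, ht, T, -, hT, -⟩ := ((eventually_ge_atTop N).and hev).exists
  have h_tail := hN (t + (T + 1)) (by omega) t ht
  rw [Real.dist_eq, ← Finset.sum_Ico_eq_sub _ (by omega), ← add_assoc,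
    Finset.Ico_add_one_right_eq_Icc] at h_tail
  linarith [lt_of_abs_lt h_tail]

theorem tendsto_zero_of_summable_sq {a : ℕ → ℝ} (ha : ∀ t, 0 ≤ a t)
    (ha_sq : Summable fun t => a t ^ 2) : Tendsto a atTop (𝓝 0) := by
  simpa only [Real.sqrt_sq (ha _), Real.sqrt_zero] using ha_sq.tendsto_atTop_zero.sqrt

theorem eventually_forall_add_le {a : ℕ → ℝ} (ha : ∀ᶠ t in atTop, a (t + 1) ≤ a t) :
    ∀ᶠ t in atTop, ∀ i, a (t + i) ≤ a t := by
  obtain ⟨N, hN⟩ := eventually_atTop.1 ha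
  filter_upwards [eventually_ge_atTop N] with t ht i
  exact antitoneOn_nat_Ici_of_succ_le hN ht (ht.trans (Nat.le_add_right t i))
    (Nat.le_add_right t i)

theorem SlowDecay.eventually_succ_le {a : ℕ → ℝ} (h : SlowDecay a) (ha : ∀ t, 0 < a t) :
    ∀ᶠ t in atTop, a (t + 1) ≤ a t := by
  obtain ⟨⟨c, -, -, hc⟩, -⟩ := h
  filter_upwards [hc] with t ht
  exact (div_le_one (ha t)).1 ht.2

end RealSequences

section BlockDescent

variable {a V : ℕ → ℝ} {K : ℝ} {t : ℕ}

theorem one_add_le_pow_mul_one_add (hK : 0 ≤ K) (ha : ∀ s, 0 ≤ a s) (hV : ∀ s, 0 ≤ V s)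
    (hV_incr : ∀ s, |V (s + 1) - V s| ≤ K * (a s * (1 + V s))) (hat : ∀ i, a (t + i) ≤ a t)
    (r : ℕ) : 1 + V (t + r) ≤ (1 + K * a t) ^ r * (1 + V t) := by
  have := ha t
  induction r with
  | zero => simp
  | succ r ih =>
    have h_nonneg := hV (t + r)
    calc 1 + V (t + r + 1) ≤ (1 + K * a (t + r)) * (1 + V (t + r)) := by
          linarith [le_of_abs_le (hV_incr (t + r))]
      _ ≤ (1 + K * a t) * ((1 + K * a t) ^ r * (1 + V t)) := by gcongr; exact hat r
      _ = (1 + K * a t) ^ (r + 1) * (1 + V t) := by ring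

theorem abs_add_sub_le (hK : 0 ≤ K) (ha : ∀ s, 0 ≤ a s) (hV : ∀ s, 0 ≤ V s)
    (hV_incr : ∀ s, |V (s + 1) - V s| ≤ K * (a s * (1 + V s))) (hat : ∀ i, a (t + i) ≤ a t)
    {f : ℕ → ℝ} (hf : ∀ s, |f (s + 1) - f s| ≤ K * (a s * (1 + V s))) {r τ : ℕ} (hr : r ≤ τ) :
    |f (t + r) - f t| ≤ τ * (K * (1 + K * a t) ^ τ) * (a t * (1 + V t)) := by
  have := ha t
  have := hV t
  calc |f (t + r) - f t| = |∑ i ∈ Finset.range r, (f (t + (i + 1)) - f (t + i))| := by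
        rw [Finset.sum_range_sub (fun i => f (t + i)), add_zero]
    _ ≤ ∑ i ∈ Finset.range r, |f (t + (i + 1)) - f (t + i)| := Finset.abs_sum_le_sum_abs _ _
    _ ≤ ∑ i ∈ Finset.range r, K * (a t * ((1 + K * a t) ^ τ * (1 + V t))) := by
        refine Finset.sum_le_sum fun i hi => (hf (t + i)).trans ?_
        have h_nonneg := hV (t + i)
        have h_growth := one_add_le_pow_mul_one_add hK ha hV hV_incr hat i
        have hi : i ≤ τ := (Finset.mem_range.1 hi).le.trans hr
        have h_base : 1 ≤ 1 + K * a t := by nlinarith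
        gcongr
        · exact hat i
        · exact h_growth.trans (by gcongr)
    _ ≤ τ * (K * (1 + K * a t) ^ τ) * (a t * (1 + V t)) := by
        rw [Finset.sum_const, Finset.card_range, nsmul_eq_mul]
        calc (r : ℝ) * (K * (a t * ((1 + K * a t) ^ τ * (1 + V t))))
            ≤ τ * (K * (a t * ((1 + K * a t) ^ τ * (1 + V t)))) := by gcongr
          _ = _ := by ring

-- Freezing the drift `q (t + r)` at the start of the block costs `O(a t ^ 2 * (1 + V t))`.
theorem block_le_sub_sum_add (hK : 0 ≤ K) (ha : ∀ s, 0 ≤ a s) (hV : ∀ s, 0 ≤ V s)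
    (hV_incr : ∀ s, |V (s + 1) - V s| ≤ K * (a s * (1 + V s))) (hat : ∀ i, a (t + i) ≤ a t)
    {q : ℕ → ℕ → ℝ} (hq : ∀ r s, |q r (s + 1) - q r s| ≤ K * (a s * (1 + V s)))
    (h_step : ∀ s, V (s + 1) ≤ V s - a s * q s s + K * (a s ^ 2 * (1 + V s))) (τ : ℕ) :
    V (t + τ) ≤ V t - ∑ r ∈ Finset.range τ, a (t + r) * q (t + r) t
      + τ * ((τ + 1) * (K * (1 + K * a t) ^ τ)) * (a t ^ 2 * (1 + V t)) := by
  set G := (1 + K * a t) ^ τ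
  have hat0 := ha t
  have hVt := hV t
  have h_base : 1 ≤ 1 + K * a t := by nlinarith
  have : 0 ≤ G := by positivity
  have h_term : ∀ r ∈ Finset.range τ, V (t + r + 1) - V (t + r)
      ≤ -(a (t + r) * q (t + r) t) + (τ + 1) * (K * G) * (a t ^ 2 * (1 + V t)) := by
    intro r hr
    have hr : r ≤ τ := (Finset.mem_range.1 hr).le
    have har := ha (t + r)
    have hVr := hV (t + r)
    have h_drift : a (t + r) * |q (t + r) (t + r) - q (t + r) t|
        ≤ a t * (τ * (K * G) * (a t * (1 + V t))) :=
      mul_le_mul (hat r) (abs_add_sub_le hK ha hV hV_incr hat (hq (t + r)) hr) (abs_nonneg _) hat0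
    have h_freeze := mul_le_mul_of_nonneg_left
      (neg_abs_le (q (t + r) (t + r) - q (t + r) t)) har
    have h_growth : 1 + V (t + r) ≤ G * (1 + V t) :=
      (one_add_le_pow_mul_one_add hK ha hV hV_incr hat r).trans
        (mul_le_mul_of_nonneg_right (pow_le_pow_right₀ h_base hr) (by positivity))
    have h_quad : K * (a (t + r) ^ 2 * (1 + V (t + r))) ≤ K * (a t ^ 2 * (G * (1 + V t))) := by
      gcongr
      exact hat r
    linarith [h_step (t + r)]
  have h_sum := Finset.sum_le_sum h_term
  simp only [add_assoc] at h_sum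
  rw [Finset.sum_range_sub (fun r => V (t + r)), add_zero, Finset.sum_add_distrib,
    Finset.sum_neg_distrib, Finset.sum_const, Finset.card_range, nsmul_eq_mul] at h_sum
  linarith

theorem tendsto_zero_of_tendsto_zero_mul {τ : ℕ} (hτ : 0 < τ) (hK : 0 ≤ K) (ha : ∀ s, 0 ≤ a s)
    (hV : ∀ s, 0 ≤ V s) (hV_incr : ∀ s, |V (s + 1) - V s| ≤ K * (a s * (1 + V s)))
    (ha_zero : Tendsto a atTop (𝓝 0)) (hat : ∀ᶠ t in atTop, ∀ i, a (t + i) ≤ a t)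
    (hVτ : Tendsto (fun k => V (k * τ)) atTop (𝓝 0)) : Tendsto V atTop (𝓝 0) := by
  have h_mul : Tendsto (fun k => k * τ) atTop atTop := tendsto_id.atTop_mul_const' hτ
  have haτ := ha_zero.comp h_mul
  have h_bound : Tendsto (fun k => V (k * τ) +
      τ * (K * (1 + K * a (k * τ)) ^ τ) * (a (k * τ) * (1 + V (k * τ)))) atTop (𝓝 0) := by
    simpa using hVτ.add ((((haτ.const_mul K).const_add 1).pow τ |>.const_mul K |>.const_mul
      (τ : ℝ)).mul (haτ.mul (hVτ.const_add 1)))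
  have h_div : Tendsto (fun t => t / τ) atTop atTop := Nat.tendsto_div_const_atTop hτ.ne'
  refine squeeze_zero' (.of_forall hV) ?_ (h_bound.comp h_div)
  filter_upwards [(h_mul.comp h_div).eventually hat] with t ht
  have h_incr := le_of_abs_le
    (abs_add_sub_le hK ha hV hV_incr ht hV_incr (Nat.mod_lt t hτ).le)
  simp only [Function.comp_apply, Nat.div_add_mod'] at h_incr ⊢
  linarith

theorem tendsto_zero_of_block_descent {q : ℕ → ℕ → ℝ} {c : ℝ} {τ : ℕ} (hτ : 0 < τ)
    (ha : ∀ s, 0 ≤ a s) (ha_anti : ∀ᶠ s in atTop, a (s + 1) ≤ a s) (ha_sum : ¬ Summable a)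
    (ha_sq : Summable fun s => a s ^ 2) (hK : 0 ≤ K) (hV : ∀ s, 0 ≤ V s)
    (hV_incr : ∀ s, |V (s + 1) - V s| ≤ K * (a s * (1 + V s)))
    (hq : ∀ r s, |q r (s + 1) - q r s| ≤ K * (a s * (1 + V s)))
    (h_step : ∀ s, V (s + 1) ≤ V s - a s * q s s + K * (a s ^ 2 * (1 + V s))) (hc : 0 < c)
    (h_coercive : ∀ᶠ k in atTop, c * a (k * τ) * V (k * τ) ≤
      ∑ s ∈ Finset.Ico (k * τ) ((k + 1) * τ), a s * q s (k * τ)) :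
    Tendsto V atTop (𝓝 0) := by
  have h_mul : Tendsto (fun k => k * τ) atTop atTop := tendsto_id.atTop_mul_const' hτ
  have ha_zero := tendsto_zero_of_summable_sq ha ha_sq
  have hat := eventually_forall_add_le ha_anti
  refine tendsto_zero_of_tendsto_zero_mul hτ hK ha hV hV_incr ha_zero hat ?_
  set E := τ * ((τ + 1) * (K * (1 + K * 1) ^ τ))
  have : 0 ≤ E := by positivity
  refine tendsto_zero_of_le_one_sub_mul_add (p := fun k => c / 2 * a (k * τ))
    (q := fun k => E * a (k * τ) ^ 2) (fun k => hV _) (fun k => mul_nonneg (by positivity) (ha _))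
    (fun k => by positivity) ?_ ?_ ?_
  · rw [summable_mul_left_iff (by positivity)]
    exact fun hs => ha_sum (summable_of_summable_comp_mul_right ha ha_anti hτ hs)
  · exact (ha_sq.comp_injective (mul_left_injective₀ hτ.ne')).mul_left E
  · have h_small : ∀ᶠ k in atTop, E * a (k * τ) < c / 2 := by
      refine ((ha_zero.comp h_mul).const_mul E).eventually_lt_const ?_
      simpa using hc
    filter_upwards [h_mul.eventually hat, h_coercive, h_small,
      (ha_zero.comp h_mul).eventually_le_const one_pos] with k hat hk hEk ha_le
    have h_block := block_le_sub_sum_add hK ha hV hV_incr hat hq h_step τ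
    rw [Finset.sum_Ico_eq_sum_range, ← Nat.sub_mul, Nat.add_sub_cancel_left, one_mul] at hk
    rw [add_one_mul]
    have hak := ha (k * τ)
    have hVk := hV (k * τ)
    have h_const : τ * ((τ + 1) * (K * (1 + K * a (k * τ)) ^ τ)) ≤ E := by
      simp only [E]
      gcongr
      exact ha_le
    have h_error := mul_le_mul_of_nonneg_right h_const
      (by positivity : 0 ≤ a (k * τ) ^ 2 * (1 + V (k * τ)))
    have h_absorb := mul_le_mul_of_nonneg_right hEk.le (mul_nonneg hak hVk)
    linarith

end BlockDescent

section SecondMoments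

variable {Ω ι E F G : Type*} [MeasurableSpace Ω] {P : Measure Ω}
  [NormedAddCommGroup E] [NormedAddCommGroup F] [NormedAddCommGroup G]

theorem integral_norm_add_sq_le {X Y : Ω → E} (hX : MemLp X 2 P) (hY : MemLp Y 2 P) :
    ∫ ω, ‖X ω + Y ω‖ ^ 2 ∂P ≤ 2 * ((∫ ω, ‖X ω‖ ^ 2 ∂P) + ∫ ω, ‖Y ω‖ ^ 2 ∂P) := by
  have hX_sq := hX.integrable_norm_pow two_ne_zero
  have hY_sq := hY.integrable_norm_pow two_ne_zero
  rw [← integral_add hX_sq hY_sq, ← integral_const_mul]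
  refine integral_mono ((hX.add hY).integrable_norm_pow two_ne_zero)
    ((hX_sq.add hY_sq).const_mul 2) fun ω => ?_
  exact (pow_le_pow_left₀ (norm_nonneg _) (norm_add_le _ _) 2).trans add_sq_le

theorem norm_integral_le_of_memLp_two [NormedSpace ℝ E] [IsProbabilityMeasure P] {X : Ω → E}
    (hX : MemLp X 2 P) : ‖∫ ω, X ω ∂P‖ ≤ (∫ ω, ‖X ω‖ ^ 2 ∂P) + 1 := by
  have hX_sq := hX.integrable_norm_pow two_ne_zero
  calc ‖∫ ω, X ω ∂P‖ ≤ ∫ ω, ‖X ω‖ ∂P := norm_integral_le_integral_norm _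
    _ ≤ ∫ ω, (‖X ω‖ ^ 2 + 1) ∂P :=
        integral_mono (hX.integrable one_le_two).norm (hX_sq.add (integrable_const _)) fun ω => by
          simp only
          nlinarith [sq_nonneg (‖X ω‖ - 1)]
    _ = _ := by simp [integral_add hX_sq (integrable_const _)]

theorem integrable_norm_sq_mul_of_indepFun [MeasurableSpace E] [OpensMeasurableSpace E]
    [MeasurableSpace F] [OpensMeasurableSpace F] {X : Ω → E} {Y : Ω → F}
    (hX : MemLp X 2 P) (hY : MemLp Y 2 P) (hXY : IndepFun X Y P) :
    Integrable (fun ω => ‖X ω‖ ^ 2 * ‖Y ω‖ ^ 2) P :=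
  (hXY.comp (measurable_norm.pow_const 2) (measurable_norm.pow_const 2)).integrable_mul
    (hX.integrable_norm_pow two_ne_zero) (hY.integrable_norm_pow two_ne_zero)

section Bilinear

variable [NormedSpace ℝ E] [NormedSpace ℝ F] [NormedSpace ℝ G] (B : E →L[ℝ] F →L[ℝ] G)

theorem norm_bilin_sq_le (x : E) (y : F) : ‖B x y‖ ^ 2 ≤ ‖B‖ ^ 2 * (‖x‖ ^ 2 * ‖y‖ ^ 2) := by
  rw [← mul_pow, ← mul_pow, ← mul_assoc]
  exact pow_le_pow_left₀ (norm_nonneg _) (B.le_opNorm₂ x y) 2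

variable [MeasurableSpace E] [OpensMeasurableSpace E] [MeasurableSpace F] [OpensMeasurableSpace F]
  {X : Ω → E} {Y : Ω → F}

theorem memLp_two_bilin_of_indepFun (hX : MemLp X 2 P) (hY : MemLp Y 2 P)
    (hXY : IndepFun X Y P) : MemLp (fun ω => B (X ω) (Y ω)) 2 P := by
  have h_meas := B.aestronglyMeasurable_comp₂ hX.1 hY.1
  refine (memLp_two_iff_integrable_sq_norm h_meas).2 ?_
  refine ((integrable_norm_sq_mul_of_indepFun hX hY hXY).const_mul (‖B‖ ^ 2)).mono'
    (h_meas.norm.pow 2) (.of_forall fun ω => ?_)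
  rw [Real.norm_of_nonneg (sq_nonneg _)]
  exact norm_bilin_sq_le B _ _

theorem integral_norm_bilin_sq_le (hX : MemLp X 2 P) (hY : MemLp Y 2 P) (hXY : IndepFun X Y P) :
    ∫ ω, ‖B (X ω) (Y ω)‖ ^ 2 ∂P ≤
      ‖B‖ ^ 2 * ((∫ ω, ‖X ω‖ ^ 2 ∂P) * ∫ ω, ‖Y ω‖ ^ 2 ∂P) := by
  have h_indep : IndepFun (fun ω => ‖X ω‖ ^ 2) (fun ω => ‖Y ω‖ ^ 2) P :=
    hXY.comp (measurable_norm.pow_const 2) (measurable_norm.pow_const 2)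
  rw [← h_indep.integral_fun_mul_eq_mul_integral (hX.1.norm.pow 2) (hY.1.norm.pow 2),
    ← integral_const_mul]
  exact integral_mono
    ((memLp_two_bilin_of_indepFun B hX hY hXY).integrable_norm_pow two_ne_zero)
    ((integrable_norm_sq_mul_of_indepFun hX hY hXY).const_mul _) fun ω => norm_bilin_sq_le B _ _

end Bilinear

/-- A family of square integrable random variables with uniformly bounded second moments, the
moment condition on the gains and noises of a stochastic approximation recursion. -/
def L2Bdd (P : Measure Ω) (X : ι → Ω → E) : Prop :=
  (∀ i, MemLp (X i) 2 P) ∧ ∃ C, ∀ i, ∫ ω, ‖X i ω‖ ^ 2 ∂P ≤ C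

namespace L2Bdd

variable {X Y : ι → Ω → E}

theorem exists_nonneg_bound (hX : L2Bdd P X) : ∃ C, 0 ≤ C ∧ ∀ i, ∫ ω, ‖X i ω‖ ^ 2 ∂P ≤ C := by
  obtain ⟨C, hC⟩ := hX.2
  exact ⟨max C 0, le_max_right _ _, fun i => (hC i).trans (le_max_left _ _)⟩

theorem zero : L2Bdd P fun (_ : ι) (_ : Ω) => (0 : E) := ⟨fun _ => MemLp.zero', 0, by simp⟩

theorem add (hX : L2Bdd P X) (hY : L2Bdd P Y) : L2Bdd P fun i ω => X i ω + Y i ω := by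
  obtain ⟨hX, C, hC⟩ := hX
  obtain ⟨hY, D, hD⟩ := hY
  refine ⟨fun i => (hX i).add (hY i), 2 * (C + D), fun i => ?_⟩
  exact (integral_norm_add_sq_le (hX i) (hY i)).trans (by gcongr; exacts [hC i, hD i])

theorem sum {κ : Type*} (s : Finset κ) {X : κ → ι → Ω → E} (hX : ∀ k ∈ s, L2Bdd P (X k)) :
    L2Bdd P fun i ω => ∑ k ∈ s, X k i ω := by
  classical
  induction s using Finset.induction_on with
  | empty => simpa only [Finset.sum_empty] using zero
  | insert k s hk ih =>
    simp only [Finset.sum_insert hk]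
    exact (hX k (s.mem_insert_self k)).add (ih fun j hj => hX j (Finset.mem_insert_of_mem hj))

theorem const [IsProbabilityMeasure P] {x : ι → E} {C : ℝ} (hx : ∀ i, ‖x i‖ ≤ C) :
    L2Bdd P fun i (_ : Ω) => x i :=
  ⟨fun _ => memLp_const _, C ^ 2, fun i => by
    simpa using pow_le_pow_left₀ (norm_nonneg _) (hx i) 2⟩

theorem ite (hX : L2Bdd P X) (p : ι → Prop) [DecidablePred p] :
    L2Bdd P fun i ω => if p i then X i ω else 0 := by
  obtain ⟨C, hC, hXC⟩ := hX.exists_nonneg_bound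
  refine ⟨fun i => ?_, C, fun i => ?_⟩
  · by_cases h : p i
    · simpa only [if_pos h] using hX.1 i
    · simpa only [if_neg h] using MemLp.zero'
  · by_cases h : p i
    · simpa only [if_pos h] using hXC i
    · simpa only [if_neg h, norm_zero, ne_eq, two_ne_zero, not_false_eq_true, zero_pow,
        integral_zero] using hC

theorem sum_varying {κ : Type*} [Finite κ] (s : ι → Finset κ) {X : κ → ι → Ω → E}
    (hX : ∀ k, L2Bdd P (X k)) : L2Bdd P fun i ω => ∑ k ∈ s i, X k i ω := by
  classical
  cases nonempty_fintype κ
  have h_sum := sum Finset.univ fun k _ => (hX k).ite fun i => k ∈ s i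
  simpa only [Finset.sum_ite_mem, Finset.univ_inter] using h_sum

section Linear

variable [NormedSpace ℝ E] [NormedSpace ℝ F] [NormedSpace ℝ G]

theorem clm_apply (hX : L2Bdd P X) {A : ι → E →L[ℝ] F} {C : ℝ} (hA : ∀ i, ‖A i‖ ≤ C) :
    L2Bdd P fun i ω => A i (X i ω) := by
  obtain ⟨hX, D, hD⟩ := hX
  refine ⟨fun i => (A i).comp_memLp' (hX i), C ^ 2 * D, fun i => ?_⟩
  have hAX := (A i).comp_memLp' (hX i)
  calc ∫ ω, ‖A i (X i ω)‖ ^ 2 ∂P ≤ ∫ ω, C ^ 2 * ‖X i ω‖ ^ 2 ∂P :=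
        integral_mono (hAX.integrable_norm_pow two_ne_zero)
          (((hX i).integrable_norm_pow two_ne_zero).const_mul _) fun ω => by
            rw [← mul_pow]
            exact pow_le_pow_left₀ (norm_nonneg _) ((A i).le_of_opNorm_le (hA i) _) 2
    _ ≤ C ^ 2 * D := by
        rw [integral_const_mul]
        gcongr
        exact hD i

theorem const_mul {X : ι → Ω → ℝ} (hX : L2Bdd P X) {c : ι → ℝ} {C : ℝ} (hc : ∀ i, |c i| ≤ C) :
    L2Bdd P fun i ω => c i * X i ω :=
  hX.clm_apply (A := fun i => ContinuousLinearMap.mul ℝ ℝ (c i)) fun i => by simpa using hc i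

theorem neg (hX : L2Bdd P X) : L2Bdd P fun i ω => -X i ω :=
  hX.clm_apply (A := fun _ => -.id ℝ E) fun _ => le_rfl

theorem smul_const {X : ι → Ω → ℝ} (hX : L2Bdd P X) (x : E) : L2Bdd P fun i ω => X i ω • x :=
  hX.clm_apply (A := fun _ => .toSpanSingleton ℝ x) fun _ => le_rfl

theorem bilin_of_indepFun [MeasurableSpace E] [OpensMeasurableSpace E] [MeasurableSpace F]
    [OpensMeasurableSpace F] {Y : ι → Ω → F} (B : E →L[ℝ] F →L[ℝ] G) (hX : L2Bdd P X)
    (hY : L2Bdd P Y) (hXY : ∀ i, IndepFun (X i) (Y i) P) :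
    L2Bdd P fun i ω => B (X i ω) (Y i ω) := by
  obtain ⟨C, hC, hXC⟩ := hX.exists_nonneg_bound
  obtain ⟨D, hYD⟩ := hY.2
  refine ⟨fun i => memLp_two_bilin_of_indepFun B (hX.1 i) (hY.1 i) (hXY i),
    ‖B‖ ^ 2 * (C * D), fun i => ?_⟩
  refine (integral_norm_bilin_sq_le B (hX.1 i) (hY.1 i) (hXY i)).trans ?_
  gcongr
  exacts [hXC i, hYD i]

theorem mul_of_indepFun {X Y : ι → Ω → ℝ} (hX : L2Bdd P X) (hY : L2Bdd P Y)
    (hXY : ∀ i, IndepFun (X i) (Y i) P) : L2Bdd P fun i ω => X i ω * Y i ω :=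
  bilin_of_indepFun (ContinuousLinearMap.mul ℝ ℝ) hX hY hXY

end Linear

end L2Bdd

/-- An integrable random variable with zero mean; integrability excludes the junk value `0` of the
integral. -/
def Centered [NormedSpace ℝ E] (P : Measure Ω) (X : Ω → E) : Prop :=
  Integrable X P ∧ ∫ ω, X ω ∂P = 0

namespace Centered

variable [NormedSpace ℝ E]

theorem add {X Y : Ω → E} (hX : Centered P X) (hY : Centered P Y) :
    Centered P fun ω => X ω + Y ω :=
  ⟨hX.1.add hY.1, by rw [integral_add hX.1 hY.1, hX.2, hY.2, add_zero]⟩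

theorem sum {κ : Type*} (s : Finset κ) {X : κ → Ω → E} (hX : ∀ k ∈ s, Centered P (X k)) :
    Centered P fun ω => ∑ k ∈ s, X k ω :=
  ⟨integrable_finsetSum _ fun k hk => (hX k hk).1, by
    rw [integral_finsetSum _ fun k hk => (hX k hk).1]
    exact Finset.sum_eq_zero fun k hk => (hX k hk).2⟩

theorem const_mul {X : Ω → ℝ} (hX : Centered P X) (c : ℝ) : Centered P fun ω => c * X ω :=
  ⟨hX.1.const_mul c, by rw [integral_const_mul, hX.2, mul_zero]⟩

theorem mul_of_indepFun {X Y : Ω → ℝ} (hX : Integrable X P) (hY : Centered P Y)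
    (hXY : IndepFun X Y P) : Centered P fun ω => X ω * Y ω :=
  ⟨hXY.integrable_mul hX hY.1, by
    rw [hXY.integral_fun_mul_eq_mul_integral hX.1 hY.1.1, hY.2, mul_zero]⟩

end Centered

end SecondMoments

section QuadraticForms

open scoped RealInnerProductSpace

variable {Ω E : Type*} [MeasurableSpace Ω] {P : Measure Ω} [NormedAddCommGroup E]
  [InnerProductSpace ℝ E] {X U : Ω → E}

theorem integrable_inner_of_memLp (hX : MemLp X 2 P) (hU : MemLp U 2 P) :
    Integrable (fun ω => ⟪X ω, U ω⟫) P :=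
  memLp_one_iff_integrable.1 ((innerSL ℝ).memLp_of_bilin 1 hX hU)

theorem integrable_inner_clm_of_memLp (hX : MemLp X 2 P) (T : E →L[ℝ] E) :
    Integrable (fun ω => ⟪X ω, T (X ω)⟫) P :=
  integrable_inner_of_memLp hX (T.comp_memLp' hX)

theorem abs_inner_clm_sub_le (T : E →L[ℝ] E) {a : ℝ} (ha : 0 ≤ a) (x u : E) :
    |⟪x + a • u, T (x + a • u)⟫ - ⟪x, T x⟫| ≤
      ‖T‖ * (a * (‖x‖ ^ 2 + ‖u‖ ^ 2) + a ^ 2 * ‖u‖ ^ 2) := by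
  have h_expand : ⟪x + a • u, T (x + a • u)⟫ - ⟪x, T x⟫ =
      a * (⟪x, T u⟫ + ⟪u, T x⟫) + a ^ 2 * ⟪u, T u⟫ := by
    simp only [map_add, map_smul, inner_add_left, inner_add_right, real_inner_smul_left,
      real_inner_smul_right]
    ring
  have h_inner (y z : E) : |⟪y, T z⟫| ≤ ‖T‖ * (‖y‖ * ‖z‖) :=
    calc |⟪y, T z⟫| ≤ ‖y‖ * ‖T z‖ := abs_real_inner_le_norm _ _
      _ ≤ ‖y‖ * (‖T‖ * ‖z‖) := by gcongr; exact T.le_opNorm z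
      _ = ‖T‖ * (‖y‖ * ‖z‖) := by ring
  calc _ ≤ a * (|⟪x, T u⟫| + |⟪u, T x⟫|) + a ^ 2 * |⟪u, T u⟫| := by
        rw [h_expand]
        refine (abs_add_le _ _).trans ?_
        rw [abs_mul, abs_mul, abs_of_nonneg ha, abs_of_nonneg (sq_nonneg a)]
        gcongr
        exact abs_add_le _ _
    _ ≤ a * (‖T‖ * (‖x‖ * ‖u‖) + ‖T‖ * (‖u‖ * ‖x‖)) + a ^ 2 * (‖T‖ * (‖u‖ * ‖u‖)) := by
        gcongr <;> exact h_inner _ _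
    _ = ‖T‖ * (a * (2 * ‖x‖ * ‖u‖) + a ^ 2 * ‖u‖ ^ 2) := by ring
    _ ≤ _ := by gcongr; exact two_mul_le_add_sq _ _

theorem abs_integral_inner_clm_sub_le (hX : MemLp X 2 P) (hU : MemLp U 2 P) (T : E →L[ℝ] E)
    {a : ℝ} (ha : 0 ≤ a) :
    |(∫ ω, ⟪X ω + a • U ω, T (X ω + a • U ω)⟫ ∂P) - ∫ ω, ⟪X ω, T (X ω)⟫ ∂P| ≤
      ‖T‖ * (a * ((∫ ω, ‖X ω‖ ^ 2 ∂P) + ∫ ω, ‖U ω‖ ^ 2 ∂P) + a ^ 2 * ∫ ω, ‖U ω‖ ^ 2 ∂P) := by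
  have hXU : MemLp (fun ω => X ω + a • U ω) 2 P := hX.add (hU.const_smul a)
  have hX_sq := hX.integrable_norm_pow two_ne_zero
  have hU_sq := hU.integrable_norm_pow two_ne_zero
  have h_sum : Integrable (fun ω => a * (‖X ω‖ ^ 2 + ‖U ω‖ ^ 2)) P :=
    (hX_sq.add hU_sq).const_mul a
  rw [← integral_sub (integrable_inner_clm_of_memLp hXU T) (integrable_inner_clm_of_memLp hX T),
    ← integral_add hX_sq hU_sq, ← integral_const_mul, ← integral_const_mul,
    ← integral_add h_sum (hU_sq.const_mul _), ← integral_const_mul]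
  exact abs_integral_le_integral_abs.trans <| integral_mono
    ((integrable_inner_clm_of_memLp hXU T).sub (integrable_inner_clm_of_memLp hX T)).abs
    ((h_sum.add (hU_sq.const_mul _)).const_mul _) fun ω => abs_inner_clm_sub_le T ha _ _

theorem integral_norm_add_smul_sq (hX : MemLp X 2 P) (hU : MemLp U 2 P) (a : ℝ) :
    ∫ ω, ‖X ω + a • U ω‖ ^ 2 ∂P =
      (∫ ω, ‖X ω‖ ^ 2 ∂P) + a * (2 * ∫ ω, ⟪X ω, U ω⟫ ∂P) + a ^ 2 * ∫ ω, ‖U ω‖ ^ 2 ∂P := by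
  have hX_sq := hX.integrable_norm_pow two_ne_zero
  have hXU := ((integrable_inner_of_memLp hX hU).const_mul 2).const_mul a
  have hU_sq := (hU.integrable_norm_pow two_ne_zero).const_mul (a ^ 2)
  have h_sum : Integrable (fun ω => ‖X ω‖ ^ 2 + a * (2 * ⟪X ω, U ω⟫)) P := hX_sq.add hXU
  rw [← integral_const_mul, ← integral_const_mul, ← integral_const_mul,
    ← integral_add hX_sq hXU, ← integral_add h_sum hU_sq]
  congr with ω
  rw [norm_add_sq_real, real_inner_smul_right, norm_smul, mul_pow, Real.norm_eq_abs, sq_abs]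
  ring

variable [CompleteSpace E] [MeasurableSpace E] [BorelSpace E]

theorem integral_inner_of_indepFun (hX : Integrable X P) (hU : Integrable U P)
    (hXU : IndepFun X U P) : ∫ ω, ⟪X ω, U ω⟫ ∂P = ⟪∫ ω, X ω ∂P, ∫ ω, U ω ∂P⟫ :=
  hXU.integral_bilin hX hU (innerSL ℝ)

set_option maxSynthPendingDepth 3 in
-- `⟪x, T x⟫` is bilinear in `T` and the functional `T ↦ ⟪x, T x⟫`, which turns the claim into
-- the product rule for independent variables.
theorem integral_inner_apply_self_of_indepFun {A : Ω → E →L[ℝ] E} (hA : Integrable A P)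
    (hX : MemLp X 2 P) (hAX : IndepFun A X P) :
    ∫ ω, ⟪X ω, A ω (X ω)⟫ ∂P = ∫ ω, ⟪X ω, (∫ ω', A ω' ∂P) (X ω)⟫ ∂P := by
  let φ (x : E) : (E →L[ℝ] E) →L[ℝ] ℝ := (innerSL ℝ x).comp (ContinuousLinearMap.apply ℝ E x)
  have hφ : Continuous φ :=
    (innerSL ℝ).continuous.clm_comp (ContinuousLinearMap.apply ℝ E).continuous
  have hφ_norm (x : E) : ‖φ x‖ ≤ ‖x‖ ^ 2 :=
    ContinuousLinearMap.opNorm_le_bound _ (by positivity) fun T => by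
      calc |⟪x, T x⟫| ≤ ‖x‖ * ‖T x‖ := abs_real_inner_le_norm _ _
        _ ≤ ‖x‖ * (‖T‖ * ‖x‖) := by gcongr; exact T.le_opNorm x
        _ = ‖x‖ ^ 2 * ‖T‖ := by ring
  have hφX : Integrable (fun ω => φ (X ω)) P :=
    (hX.integrable_norm_pow two_ne_zero).mono' (hφ.comp_aestronglyMeasurable hX.1)
      (.of_forall fun ω => hφ_norm _)
  calc ∫ ω, φ (X ω) (A ω) ∂P = (∫ ω, φ (X ω) ∂P) (∫ ω, A ω ∂P) :=
        (hAX.symm.comp hφ.measurable measurable_id).integral_bilin hφX hA (.id ℝ _)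
    _ = ∫ ω, φ (X ω) (∫ ω', A ω' ∂P) ∂P := ContinuousLinearMap.integral_apply hφX _

end QuadraticForms

/-- A stochastic approximation recursion `e (t + 1) = e t + a t • (n t - A t (e t))` with random
linear gains `A t` and centred noises `n t`, both bounded in `L²` and independent of the current
state. -/
structure IsLinearStochApprox {Ω E : Type*} [MeasurableSpace Ω] [NormedAddCommGroup E]
    [InnerProductSpace ℝ E] [MeasurableSpace E] (P : Measure Ω) (a : ℕ → ℝ)
    (A : ℕ → Ω → E →L[ℝ] E) (n e : ℕ → Ω → E) : Prop where
  succ_eq : ∀ t ω, e (t + 1) ω = e t ω + a t • (n t ω - A t ω (e t ω))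
  memLp_zero : MemLp (e 0) 2 P
  indepFun_gain : ∀ t, IndepFun (A t) (e t) P
  indepFun_noise : ∀ t, IndepFun (e t) (n t) P
  l2Bdd_gain : L2Bdd P A
  l2Bdd_noise : L2Bdd P n
  integral_noise : ∀ t, ∫ ω, n t ω ∂P = 0

namespace IsLinearStochApprox

open scoped RealInnerProductSpace

variable {Ω E : Type*} [MeasurableSpace Ω] {P : Measure Ω} [NormedAddCommGroup E]
  [InnerProductSpace ℝ E] [MeasurableSpace E] [BorelSpace E] {a : ℕ → ℝ} {A : ℕ → Ω → E →L[ℝ] E}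
  {n e : ℕ → Ω → E} (h : IsLinearStochApprox P a A n e)
include h

theorem memLp_gain_apply {t : ℕ} (he : MemLp (e t) 2 P) :
    MemLp (fun ω => A t ω (e t ω)) 2 P :=
  memLp_two_bilin_of_indepFun (.id ℝ _) (h.l2Bdd_gain.1 t) he (h.indepFun_gain t)

theorem memLp (t : ℕ) : MemLp (e t) 2 P := by
  induction t with
  | zero => exact h.memLp_zero
  | succ t ih =>
    rw [funext (h.succ_eq t)]
    exact ih.add (((h.l2Bdd_noise.1 t).sub (h.memLp_gain_apply ih)).const_smul (a t))

theorem memLp_increment (t : ℕ) : MemLp (fun ω => n t ω - A t ω (e t ω)) 2 P :=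
  (h.l2Bdd_noise.1 t).sub (h.memLp_gain_apply (h.memLp t))

theorem exists_integral_norm_increment_sq_le : ∃ K, 0 ≤ K ∧ ∀ t,
    ∫ ω, ‖n t ω - A t ω (e t ω)‖ ^ 2 ∂P ≤ K * (1 + ∫ ω, ‖e t ω‖ ^ 2 ∂P) := by
  obtain ⟨C, hC, hA⟩ := h.l2Bdd_gain.exists_nonneg_bound
  obtain ⟨D, hD, hn⟩ := h.l2Bdd_noise.exists_nonneg_bound
  refine ⟨2 * (D + C), by positivity, fun t => ?_⟩
  have hV : 0 ≤ ∫ ω, ‖e t ω‖ ^ 2 ∂P := integral_nonneg fun _ => sq_nonneg _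
  have h_gain : ∫ ω, ‖A t ω (e t ω)‖ ^ 2 ∂P ≤ C * ∫ ω, ‖e t ω‖ ^ 2 ∂P := by
    refine (integral_norm_bilin_sq_le (.id ℝ _) (h.l2Bdd_gain.1 t) (h.memLp t)
      (h.indepFun_gain t)).trans ?_
    have h_id : ‖ContinuousLinearMap.id ℝ (E →L[ℝ] E)‖ ^ 2 ≤ 1 :=
      pow_le_one₀ (ContinuousLinearMap.opNorm_nonneg _) ContinuousLinearMap.norm_id_le
    have h_mul := mul_le_mul_of_nonneg_right (hA t) hV
    have h_nonneg : 0 ≤ (∫ ω, ‖A t ω‖ ^ 2 ∂P) * ∫ ω, ‖e t ω‖ ^ 2 ∂P := by positivity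
    exact (mul_le_of_le_one_left h_nonneg h_id).trans h_mul
  have h_add := integral_norm_add_sq_le (h.l2Bdd_noise.1 t) (h.memLp_gain_apply (h.memLp t)).neg
  simp only [Pi.neg_apply, ← sub_eq_add_neg, norm_neg] at h_add
  nlinarith [hn t, mul_nonneg hD hV]

theorem exists_abs_integral_inner_clm_succ_sub_le (ha : ∀ t, 0 ≤ a t)
    (ha_bdd : BddAbove (Set.range a)) {C : ℝ} (hC : 0 ≤ C) :
    ∃ K, 0 ≤ K ∧ ∀ T : E →L[ℝ] E, ‖T‖ ≤ C → ∀ t,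
      |(∫ ω, ⟪e (t + 1) ω, T (e (t + 1) ω)⟫ ∂P) - ∫ ω, ⟪e t ω, T (e t ω)⟫ ∂P| ≤
        K * (a t * (1 + ∫ ω, ‖e t ω‖ ^ 2 ∂P)) := by
  obtain ⟨K, hK, hU⟩ := h.exists_integral_norm_increment_sq_le
  obtain ⟨D, hD⟩ := ha_bdd
  have haD (t : ℕ) : a t ≤ D := hD (Set.mem_range_self t)
  have hD₀ : 0 ≤ D := (ha 0).trans (haD 0)
  refine ⟨C * (1 + K + D * K), by positivity, fun T hT t => ?_⟩
  simp only [h.succ_eq]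
  refine (abs_integral_inner_clm_sub_le (h.memLp t) (h.memLp_increment t) T (ha t)).trans ?_
  have hat := ha t
  have hV : 0 ≤ ∫ ω, ‖e t ω‖ ^ 2 ∂P := integral_nonneg fun _ => sq_nonneg _
  set V := ∫ ω, ‖e t ω‖ ^ 2 ∂P
  calc _ ≤ C * (a t * (V + K * (1 + V)) + a t ^ 2 * (K * (1 + V))) := by
        gcongr
        exacts [hU t, hU t]
    _ ≤ C * (a t * ((1 + V) + K * (1 + V)) + a t * D * (K * (1 + V))) := by
        rw [sq]
        gcongr
        exacts [by linarith, haD t]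
    _ = _ := by ring

theorem mul_integral_norm_sq_le_sum {c : ℝ} {s : Finset ℕ} (t : ℕ)
    (hs : ∀ x : E, c * ‖x‖ ^ 2 ≤ ∑ r ∈ s, a r * (2 * ⟪x, (∫ ω, A r ω ∂P) x⟫)) :
    c * ∫ ω, ‖e t ω‖ ^ 2 ∂P ≤
      ∑ r ∈ s, a r * (2 * ∫ ω, ⟪e t ω, (∫ ω', A r ω' ∂P) (e t ω)⟫ ∂P) := by
  have h_int (r : ℕ) : Integrable
      (fun ω => a r * (2 * ⟪e t ω, (∫ ω', A r ω' ∂P) (e t ω)⟫)) P :=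
    ((integrable_inner_clm_of_memLp (h.memLp t) _).const_mul 2).const_mul (a r)
  simp only [← integral_const_mul]
  rw [← integral_finsetSum s fun r _ => h_int r]
  exact integral_mono (((h.memLp t).integrable_norm_pow two_ne_zero).const_mul c)
    (integrable_finsetSum s fun r _ => h_int r) fun ω => hs (e t ω)

variable [CompleteSpace E]

theorem integral_norm_sq_succ [IsProbabilityMeasure P] (t : ℕ) :
    ∫ ω, ‖e (t + 1) ω‖ ^ 2 ∂P = (∫ ω, ‖e t ω‖ ^ 2 ∂P) -
      a t * (2 * ∫ ω, ⟪e t ω, (∫ ω', A t ω' ∂P) (e t ω)⟫ ∂P) +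
      a t ^ 2 * ∫ ω, ‖n t ω - A t ω (e t ω)‖ ^ 2 ∂P := by
  have he := h.memLp t
  have hn := h.l2Bdd_noise.1 t
  have h_noise : ∫ ω, ⟪e t ω, n t ω⟫ ∂P = 0 := by
    rw [integral_inner_of_indepFun (he.integrable one_le_two) (hn.integrable one_le_two)
      (h.indepFun_noise t), h.integral_noise, inner_zero_right]
  have h_cross : ∫ ω, ⟪e t ω, n t ω - A t ω (e t ω)⟫ ∂P =
      -∫ ω, ⟪e t ω, (∫ ω', A t ω' ∂P) (e t ω)⟫ ∂P := by
    simp only [inner_sub_right]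
    rw [integral_sub (integrable_inner_of_memLp he hn)
        (integrable_inner_of_memLp he (h.memLp_gain_apply he)), h_noise, zero_sub,
      integral_inner_apply_self_of_indepFun ((h.l2Bdd_gain.1 t).integrable one_le_two) he
        (h.indepFun_gain t)]
  simp only [h.succ_eq]
  rw [integral_norm_add_smul_sq he (h.memLp_increment t), h_cross]
  ring

theorem tendsto_integral_norm_sq [IsProbabilityMeasure P] {c : ℝ} {τ : ℕ} (hτ : 0 < τ)
    (ha : ∀ t, 0 ≤ a t) (ha_anti : ∀ᶠ t in atTop, a (t + 1) ≤ a t) (ha_sum : ¬ Summable a)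
    (ha_sq : Summable fun t => a t ^ 2) (hc : 0 < c)
    (h_coercive : ∀ᶠ k in atTop, ∀ x : E, c * a (k * τ) * ‖x‖ ^ 2 ≤
      ∑ s ∈ Finset.Ico (k * τ) ((k + 1) * τ), a s * (2 * ⟪x, (∫ ω, A s ω ∂P) x⟫)) :
    Tendsto (fun t => ∫ ω, ‖e t ω‖ ^ 2 ∂P) atTop (𝓝 0) := by
  have ha_bdd : BddAbove (Set.range a) := (tendsto_zero_of_summable_sq ha ha_sq).bddAbove_range
  obtain ⟨C, hC, hA⟩ := h.l2Bdd_gain.exists_nonneg_bound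
  have hA_mean (t : ℕ) : ‖∫ ω, A t ω ∂P‖ ≤ C + 1 :=
    (norm_integral_le_of_memLp_two (h.l2Bdd_gain.1 t)).trans (by gcongr; exact hA t)
  obtain ⟨K, hK, hU⟩ := h.exists_integral_norm_increment_sq_le
  obtain ⟨K', hK', h_quad⟩ := h.exists_abs_integral_inner_clm_succ_sub_le ha ha_bdd
    (by positivity : 0 ≤ 2 * (C + 1))
  have hV (t : ℕ) : 0 ≤ ∫ ω, ‖e t ω‖ ^ 2 ∂P := integral_nonneg fun _ => sq_nonneg _
  have h_quad_le (T : E →L[ℝ] E) (hT : ‖T‖ ≤ 2 * (C + 1)) (t : ℕ) := (h_quad T hT t).trans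
    (mul_le_mul_of_nonneg_right (le_add_of_nonneg_left hK)
      (mul_nonneg (ha t) (add_nonneg zero_le_one (hV t))))
  refine tendsto_zero_of_block_descent (K := K + K')
    (q := fun r t => 2 * ∫ ω, ⟪e t ω, (∫ ω', A r ω' ∂P) (e t ω)⟫ ∂P)
    hτ ha ha_anti ha_sum ha_sq (by positivity) hV (fun t => ?_) (fun r t => ?_) (fun t => ?_) hc
    (h_coercive.mono fun k hk => h.mul_integral_norm_sq_le_sum _ hk)
  · have h_id : ‖ContinuousLinearMap.id ℝ E‖ ≤ 2 * (C + 1) :=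
      ContinuousLinearMap.norm_id_le.trans (by linarith)
    simpa using h_quad_le _ h_id t
  · have h_two : ‖(2 : ℝ) • ∫ ω, A r ω ∂P‖ ≤ 2 * (C + 1) := by
      rw [norm_smul, Real.norm_two]
      gcongr
      exact hA_mean r
    simpa only [_root_.smul_apply, real_inner_smul_right, integral_const_mul]
      using h_quad_le _ h_two t
  · rw [h.integral_norm_sq_succ t, mul_left_comm (K + K')]
    gcongr _ + _ * ?_
    exact (hU t).trans (mul_le_mul_of_nonneg_right (le_add_of_nonneg_right hK')
      (add_nonneg zero_le_one (hV t)))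

end IsLinearStochApprox

section Matrices

open scoped RealInnerProductSpace
open Matrix (toEuclideanCLM)

theorem minEigenvalue_mul_norm_sq_le {n : Type*} [Fintype n] [DecidableEq n] {A : Matrix n n ℝ}
    (hA : A.IsHermitian) (x : EuclideanSpace ℝ n) :
    minEigenvalue A * ‖x‖ ^ 2 ≤ ⟪x, toEuclideanCLM (𝕜 := ℝ) A x⟫ := by
  have h_pos : (A - algebraMap ℝ (Matrix n n ℝ) (minEigenvalue A)).PosSemidef := by
    rw [Matrix.posSemidef_iff_isHermitian_and_spectrum_nonneg]
    refine ⟨hA.sub (Matrix.isHermitian_diagonal _), fun μ hμ => ?_⟩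
    rw [← spectrum.sub_singleton_eq] at hμ
    obtain ⟨ν, hν, _, rfl, rfl⟩ := hμ
    exact sub_nonneg.2 (csInf_le (Matrix.finite_spectrum A).bddBelow hν)
  have h_quad : 0 ≤ ⟪x, toEuclideanCLM (𝕜 := ℝ) (A - algebraMap ℝ _ (minEigenvalue A)) x⟫ := by
    rw [Matrix.inner_toEuclideanCLM]
    exact h_pos.dotProduct_mulVec_nonneg x
  rw [map_sub, AlgHomClass.commutes, Algebra.algebraMap_eq_smul_one, _root_.sub_apply,
    inner_sub_right, _root_.smul_apply, one_apply_eq_self, real_inner_smul_right,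
    real_inner_self_eq_norm_sq, sub_nonneg] at h_quad
  exact h_quad

theorem inner_toEuclideanCLM_transpose {n : Type*} [Fintype n] [DecidableEq n]
    (A : Matrix n n ℝ) (x : EuclideanSpace ℝ n) :
    ⟪x, toEuclideanCLM (𝕜 := ℝ) A.transpose x⟫ = ⟪x, toEuclideanCLM (𝕜 := ℝ) A x⟫ := by
  rw [Matrix.inner_toEuclideanCLM, Matrix.inner_toEuclideanCLM, Matrix.mulVec_transpose,
    dotProduct_comm, Matrix.dotProduct_mulVec]

theorem toEuclideanCLM_eq_sum {n : Type*} [Fintype n] [DecidableEq n] (A : Matrix n n ℝ) :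
    toEuclideanCLM (n := n) (𝕜 := ℝ) A =
      ∑ i, ∑ j, A i j • toEuclideanCLM (n := n) (𝕜 := ℝ) (Matrix.single i j 1) := by
  conv_lhs => rw [Matrix.matrix_eq_sum_single A]
  simp only [map_sum, ← map_smul, Matrix.smul_single, smul_eq_mul, mul_one]

theorem L2Bdd.toLp {Ω ι n : Type*} [Fintype n] [MeasurableSpace Ω] {P : Measure Ω}
    {X : ι → Ω → n → ℝ} (hX : ∀ i, L2Bdd P fun t ω => X t ω i) :
    L2Bdd P fun t ω => WithLp.toLp 2 (X t ω) := by
  classical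
  have h_eq (x : n → ℝ) : WithLp.toLp 2 x = ∑ i, x i • EuclideanSpace.single i (1 : ℝ) := by
    simpa using ((EuclideanSpace.basisFun n ℝ).sum_repr (WithLp.toLp 2 x)).symm
  simp only [h_eq]
  exact .sum _ fun i _ => (hX i).smul_const _

variable {Ω n : Type*} {m : MeasurableSpace Ω}

theorem measurable_toLp {X : Ω → n → ℝ} (hX : ∀ i, Measurable[m] fun ω => X ω i) :
    Measurable[m] fun ω => WithLp.toLp 2 (X ω) :=
  (WithLp.measurable_toLp 2 _).comp (measurable_pi_lambda _ hX)

variable [Fintype n] [DecidableEq n] {mΩ : MeasurableSpace Ω} {P : Measure Ω}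

theorem measurable_toEuclideanCLM {X : Ω → Matrix n n ℝ}
    (hX : ∀ i j, Measurable[m] fun ω => X ω i j) :
    Measurable[m] fun ω => toEuclideanCLM (n := n) (𝕜 := ℝ) (X ω) := by
  simp only [fun ω => toEuclideanCLM_eq_sum (X ω)]
  exact Finset.measurable_fun_sum _ fun i _ => Finset.measurable_fun_sum _ fun j _ =>
    (hX i j).smul_const _

theorem integral_toEuclideanCLM {X : Ω → Matrix n n ℝ}
    (hX : ∀ i j, Integrable (fun ω => X ω i j) P) :
    ∫ ω, toEuclideanCLM (n := n) (𝕜 := ℝ) (X ω) ∂P = toEuclideanCLM (𝕜 := ℝ) (meanMatrix P X) := by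
  simp only [fun ω => toEuclideanCLM_eq_sum (X ω), toEuclideanCLM_eq_sum (meanMatrix P X)]
  have h_int (i j : n) := (hX i j).smul_const
    (toEuclideanCLM (n := n) (𝕜 := ℝ) (Matrix.single i j 1))
  rw [integral_finsetSum _ fun i _ => integrable_finsetSum _ fun j _ => h_int i j]
  simp only [integral_finsetSum _ fun j _ => h_int _ j, integral_smul_const, meanMatrix,
    Matrix.of_apply]

theorem L2Bdd.toEuclideanCLM {ι : Type*} {X : ι → Ω → Matrix n n ℝ}
    (hX : ∀ i j, L2Bdd P fun t ω => X t ω i j) :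
    L2Bdd P fun t ω => toEuclideanCLM (n := n) (𝕜 := ℝ) (X t ω) := by
  simp only [fun t ω => toEuclideanCLM_eq_sum (X t ω)]
  exact .sum _ fun i _ => .sum _ fun j _ => (hX i j).smul_const _

end Matrices

theorem indepFun_of_indep {Ω β γ : Type*} [MeasurableSpace Ω] [MeasurableSpace β]
    [MeasurableSpace γ] {P : Measure Ω} {m₁ m₂ : MeasurableSpace Ω} (h : Indep m₁ m₂ P)
    {X : Ω → β} {Y : Ω → γ} (hX : Measurable[m₁] X) (hY : Measurable[m₂] Y) : IndepFun X Y P :=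
  (IndepFun_iff_Indep X Y P).2 (indep_of_indep_of_le h hX.comap_le hY.comap_le)

namespace RelaySystem

section ErrorRecursion

open Matrix (toEuclideanCLM)

variable {M R : ℕ} {Ω : Type*} [MeasurableSpace Ω] (S : RelaySystem M R Ω)

/-- The vector `x(t) - θ 𝟙` of estimation errors. -/
noncomputable def err (t : ℕ) (ω : Ω) : EuclideanSpace ℝ (Fin M) :=
  WithLp.toLp 2 fun i => S.x t ω i - S.θ

/-- The perturbation `Δ w + v + θ γ` that drives the estimation error. -/
noncomputable def noise (t : ℕ) (ω : Ω) : EuclideanSpace ℝ (Fin M) :=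
  WithLp.toLp 2 ((S.Δ t).mulVec (fun i => S.w t i ω) + S.vTot t ω + S.θ • S.γ t ω)

/-- The matrix `Φ(t)` as an operator on Euclidean space, the gain of the error recursion. -/
noncomputable def gain (t : ℕ) (ω : Ω) :
    EuclideanSpace ℝ (Fin M) →L[ℝ] EuclideanSpace ℝ (Fin M) :=
  toEuclideanCLM (n := Fin M) (𝕜 := ℝ) (S.Φ t ω)

theorem L_mulVec_one (t : ℕ) (ω : Ω) : (S.L t ω).mulVec 1 = 0 := by
  ext i
  simp only [Matrix.mulVec, dotProduct, Pi.one_apply, mul_one, Pi.zero_apply]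
  rw [← Finset.add_sum_erase _ _ (Finset.mem_univ i),
    Finset.sum_congr rfl (g := S.lOff t ω i) fun j hj => by simp [L, Finset.ne_of_mem_erase hj]]
  simp [L]

theorem Φ_mulVec_one (t : ℕ) (ω : Ω) : (S.Φ t ω).mulVec 1 = (S.Δ t).mulVec 1 - S.γ t ω := by
  rw [Φ, Matrix.sub_mulVec, Matrix.add_mulVec, L_mulVec_one, add_zero]
  congr 1
  ext i
  simp [Γ, Matrix.mulVec_diagonal]

theorem err_succ (t : ℕ) (ω : Ω) :
    S.err (t + 1) ω = S.err t ω + S.a t • (S.noise t ω - S.gain t ω (S.err t ω)) := by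
  have h_y : S.y t ω = S.θ • 1 + fun i => S.w t i ω := by ext i; simp [y]
  have h_err (s : ℕ) : S.err s ω = WithLp.toLp 2 (S.x s ω - S.θ • 1) := by
    ext i
    simp [err]
  rw [h_err, h_err, gain, Matrix.toEuclideanCLM_toLp, noise, ← WithLp.toLp_sub, ← WithLp.toLp_smul,
    ← WithLp.toLp_add, x, h_y]
  simp only [Matrix.sub_mulVec, Matrix.one_mulVec, Matrix.smul_mulVec, Matrix.mulVec_add,
    Matrix.mulVec_sub, Matrix.mulVec_smul, Φ_mulVec_one]
  congr 1
  module

theorem γ_eq (t : ℕ) (ω : Ω) (i : Fin M) :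
    S.γ t ω i = ∑ j ∈ S.nbrS t (Sum.inl i), S.α t (Sum.inl j) * S.h t (Sum.inl i) (Sum.inl j) ω +
      ∑ p ∈ S.nbrR t (Sum.inl i), ∑ k ∈ S.nbrS t (Sum.inr p),
        S.α t (Sum.inr p) * (S.α t (Sum.inl k) *
          (S.h t (Sum.inl i) (Sum.inr p) ω * S.h t (Sum.inr p) (Sum.inl k) ω)) + -S.b t i := by
  simp only [γ, sub_eq_add_neg, Finset.mul_sum, mul_assoc, mul_left_comm (S.h _ _ _ _)]

theorem vTot_eq (t : ℕ) (ω : Ω) (i : Fin M) :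
    S.vTot t ω i = (∑ j ∈ S.nbrS t (Sum.inl i), S.v t (Sum.inl i) (Sum.inl j) ω +
        ∑ p ∈ S.nbrR t (Sum.inl i), S.v t (Sum.inl i) (Sum.inr p) ω) +
      ∑ p ∈ S.nbrR t (Sum.inl i), ∑ k ∈ S.nbrS t (Sum.inr p), S.α t (Sum.inr p) *
        (S.h t (Sum.inl i) (Sum.inr p) ω * S.v t (Sum.inr p) (Sum.inl k) ω) := by
  simp only [vTot, Finset.mul_sum, mul_assoc]

open Classical in
theorem noise_apply (t : ℕ) (ω : Ω) (i : Fin M) :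
    (S.noise t ω).ofLp i =
      (if i ∈ S.measuring t then 1 else 0) * S.w t i ω + S.vTot t ω i + S.θ * S.γ t ω i := by
  simp only [noise, Δ, Pi.add_apply, Matrix.mulVec_diagonal, Pi.smul_apply, smul_eq_mul]

end ErrorRecursion

section Measurability

variable {M R : ℕ} {Ω : Type*} {m mΩ : MeasurableSpace Ω} (S : RelaySystem M R Ω) {t : ℕ}

theorem measurable_lOff (hh : ∀ i j, Measurable[m] (S.h t i j)) (i j : Fin M) :
    Measurable[m] fun ω => S.lOff t ω i j := by
  unfold lOff
  refine Measurable.const_mul (Measurable.add ?_ (by fun_prop)) _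
  split_ifs
  exacts [hh _ _, measurable_const]

theorem measurable_γ (hh : ∀ i j, Measurable[m] (S.h t i j)) (i : Fin M) :
    Measurable[m] fun ω => S.γ t ω i := by
  simp only [γ_eq]
  fun_prop

theorem measurable_gain (hh : ∀ i j, Measurable[m] (S.h t i j)) : Measurable[m] (S.gain t) := by
  refine measurable_toEuclideanCLM fun i j => ?_
  simp only [Φ, Matrix.sub_apply, Matrix.add_apply, L, Γ, Matrix.diagonal_apply, Matrix.of_apply]
  refine (measurable_const.add ?_).sub ?_
  · split_ifs
    exacts [(Finset.measurable_fun_sum _ fun k _ => S.measurable_lOff hh i k).neg,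
      S.measurable_lOff hh i j]
  · split_ifs
    exacts [S.measurable_γ hh i, measurable_const]

theorem measurable_noise (hh : ∀ i j, Measurable[m] (S.h t i j))
    (hv : ∀ i j, Measurable[m] (S.v t i j)) (hw : ∀ i, Measurable[m] (S.w t i)) :
    Measurable[m] (S.noise t) := by
  have hγ := S.measurable_γ hh
  refine measurable_toLp fun i => ?_
  simp only [Δ, Pi.add_apply, Matrix.mulVec_diagonal, vTot_eq, Pi.smul_apply, smul_eq_mul]
  fun_prop

end Measurability

/-- The number of steps after which a source has entered the recursion. -/
def Source.stage {M R : ℕ} : Source M R → ℕ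
  | .init => 0
  | .meas t => t + 1
  | .recv t => t + 1
  | .fading t _ => t + 1

section Filtration

variable {M R : ℕ} {Ω : Type*} [mΩ : MeasurableSpace Ω] (S : RelaySystem M R Ω)

/-- The information available before the randomness of time `t` is revealed. -/
@[reducible]
def past (t : ℕ) : MeasurableSpace Ω := ⨆ q ∈ {q : Source M R | q.stage ≤ t}, S.sigmaOf q

/-- The randomness entering at time `t`. -/
@[reducible]
def present (t : ℕ) : MeasurableSpace Ω := ⨆ q ∈ {q : Source M R | q.stage = t + 1}, S.sigmaOf q

theorem sigmaOf_le (q : Source M R) : S.sigmaOf q ≤ mΩ := by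
  cases q
  · exact S.measurable_x₀.comap_le
  · exact (measurable_pi_lambda _ fun i => S.measurable_w _ i).comap_le
  · exact (measurable_pi_lambda _ fun q : Node M R × Node M R => S.measurable_v _ q.1 q.2).comap_le
  · exact (measurable_pi_lambda _ fun i => S.measurable_h _ i _).comap_le

theorem measurable_sigmaOf_w (t : ℕ) (i : Fin M) : Measurable[S.sigmaOf (.meas t)] (S.w t i) :=
  (measurable_pi_apply i).comp (comap_measurable fun ω (i : Fin M) => S.w t i ω)

theorem measurable_sigmaOf_v (t : ℕ) (i j : Node M R) :
    Measurable[S.sigmaOf (.recv t)] (S.v t i j) :=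
  (measurable_pi_apply (i, j)).comp
    (comap_measurable fun ω (q : Node M R × Node M R) => S.v t q.1 q.2 ω)

theorem measurable_sigmaOf_h (t : ℕ) (i j : Node M R) :
    Measurable[S.sigmaOf (.fading t j)] (S.h t i j) :=
  (measurable_pi_apply i).comp (comap_measurable fun ω (i : Node M R) => S.h t i j ω)

theorem sigmaOf_le_present {t : ℕ} {q : Source M R} (hq : q.stage = t + 1) :
    S.sigmaOf q ≤ S.present t :=
  le_biSup S.sigmaOf hq

theorem past_le_past_succ (t : ℕ) : S.past t ≤ S.past (t + 1) :=
  biSup_mono fun _ hq => Nat.le_succ_of_le hq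

theorem present_le_past_succ (t : ℕ) : S.present t ≤ S.past (t + 1) :=
  biSup_mono fun _ hq => hq.le

theorem measurable_present_h (t : ℕ) (i j : Node M R) : Measurable[S.present t] (S.h t i j) :=
  (S.measurable_sigmaOf_h t i j).mono (S.sigmaOf_le_present rfl) le_rfl

theorem measurable_present_gain (t : ℕ) : Measurable[S.present t] (S.gain t) :=
  S.measurable_gain (S.measurable_present_h t)

theorem measurable_present_noise (t : ℕ) : Measurable[S.present t] (S.noise t) :=
  S.measurable_noise (S.measurable_present_h t)
    (fun i j => (S.measurable_sigmaOf_v t i j).mono (S.sigmaOf_le_present rfl) le_rfl)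
    fun i => (S.measurable_sigmaOf_w t i).mono (S.sigmaOf_le_present rfl) le_rfl

theorem measurable_past_err (t : ℕ) : Measurable[S.past t] (S.err t) := by
  induction t with
  | zero =>
    have h_init : S.sigmaOf .init ≤ S.past 0 :=
      le_biSup S.sigmaOf (show Source.init ∈ {q : Source M R | q.stage ≤ 0} from Nat.le_refl 0)
    exact measurable_toLp fun i =>
      (((measurable_pi_apply i).comp (comap_measurable S.x₀)).sub_const _).mono h_init le_rfl
  | succ t ih =>
    have h_err := ih.mono (S.past_le_past_succ t) le_rfl
    have h_noise := (S.measurable_present_noise t).mono (S.present_le_past_succ t) le_rfl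
    have h_gain := (S.measurable_present_gain t).mono (S.present_le_past_succ t) le_rfl
    rw [funext (S.err_succ t)]
    have h_apply : Measurable[S.past (t + 1)] fun ω => S.gain t ω (S.err t ω) :=
      isBoundedBilinearMap_apply.continuous.measurable.comp (h_gain.prodMk h_err)
    exact h_err.add ((h_noise.sub h_apply).fun_const_smul _)

variable {S} {P : Measure Ω}

theorem indep_past_present (hA4 : S.Assumption4 P) (t : ℕ) :
    Indep (S.past t) (S.present t) P :=
  indep_iSup_of_disjoint S.sigmaOf_le hA4 <| Set.disjoint_left.2 fun _ h_le h_eq =>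
    absurd (h_eq.symm.trans_le h_le) (Nat.not_succ_le_self t)

theorem indepFun_err_noise (hA4 : S.Assumption4 P) (t : ℕ) :
    IndepFun (S.err t) (S.noise t) P :=
  indepFun_of_indep (indep_past_present hA4 t) (S.measurable_past_err t)
    (S.measurable_present_noise t)

theorem indepFun_gain_err (hA4 : S.Assumption4 P) (t : ℕ) :
    IndepFun (S.gain t) (S.err t) P :=
  indepFun_of_indep (indep_past_present hA4 t).symm (S.measurable_present_gain t)
    (S.measurable_past_err t)

theorem indepFun_fading_relay (hA4 : S.Assumption4 P) (t : ℕ) (i j : Node M R) (p : Fin R)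
    (k : Fin M) : IndepFun (S.h t i (Sum.inr p)) (S.h t j (Sum.inl k)) P := by
  have h_ne : (Source.fading t (Sum.inr p) : Source M R) ≠ Source.fading t (Sum.inl k) := by simp
  exact indepFun_of_indep (iIndep.indep hA4 h_ne) (S.measurable_sigmaOf_h t _ _)
    (S.measurable_sigmaOf_h t _ _)

theorem indepFun_fading_recv (hA4 : S.Assumption4 P) (t : ℕ) (i j k l : Node M R) :
    IndepFun (S.h t i j) (S.v t k l) P := by
  have h_ne : (Source.fading t j : Source M R) ≠ Source.recv t := by simp
  exact indepFun_of_indep (iIndep.indep hA4 h_ne) (S.measurable_sigmaOf_h t i j)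
    (S.measurable_sigmaOf_v t k l)

end Filtration

section Assumptions

variable {M R : ℕ} {Ω : Type*} [MeasurableSpace Ω] {S : RelaySystem M R Ω} {P : Measure Ω}

theorem l2Bdd_h (hA3 : S.Assumption3 P) (i j : Node M R) : L2Bdd P fun t => S.h t i j :=
  ⟨fun t => hA3.memLp_h t i j, hA3.bound_h.imp fun _ hC t => by
    simpa only [Real.norm_eq_abs, sq_abs] using hC t i j⟩

theorem l2Bdd_v (hA3 : S.Assumption3 P) (i j : Node M R) : L2Bdd P fun t => S.v t i j :=
  ⟨fun t => hA3.memLp_v t i j, hA3.bound_v.imp fun _ hC t => by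
    simpa only [Real.norm_eq_abs, sq_abs] using hC t i j⟩

theorem l2Bdd_w {T : ℕ} (hA2 : S.Assumption2 P T) (i : Fin M) : L2Bdd P fun t => S.w t i := by
  have h_sq : Measurable fun z : Fin M → ℝ => ‖z i‖ ^ 2 :=
    (measurable_pi_apply i).norm.pow_const 2
  exact ⟨fun t => hA2.memLp t i, ∫ ω, ‖S.w 0 i ω‖ ^ 2 ∂P, fun t =>
    ((hA2.identDistrib t).comp h_sq).integral_eq.le⟩

end Assumptions

section Moments

variable {M R : ℕ} {Ω : Type*} [MeasurableSpace Ω] {S : RelaySystem M R Ω} {P : Measure Ω}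
  (hA4 : S.Assumption4 P) {C D : ℝ} (hα : ∀ t i, S.α t i ≤ C) (hb : ∀ t i, |S.b t i| ≤ D)
  (hw : ∀ i, L2Bdd P fun t => S.w t i) (hh : ∀ i j, L2Bdd P fun t => S.h t i j)
  (hv : ∀ i j, L2Bdd P fun t => S.v t i j)

include hα in
theorem abs_α_le (t : ℕ) (i : Node M R) : |S.α t i| ≤ C :=
  (abs_of_pos (S.α_pos t i)).trans_le (hα t i)

include hA4 hh

theorem l2Bdd_relay (i k : Fin M) (p : Fin R) :
    L2Bdd P fun t ω => S.h t (Sum.inl i) (Sum.inr p) ω * S.h t (Sum.inr p) (Sum.inl k) ω :=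
  (hh _ _).mul_of_indepFun (hh _ _) fun t => indepFun_fading_relay hA4 t _ _ p k

include hα

theorem l2Bdd_lOff (i j : Fin M) : L2Bdd P fun t ω => S.lOff t ω i j := by
  refine L2Bdd.const_mul (.add ((hh _ _).ite _) (.sum_varying _ fun k => ?_))
    (C := C) fun t => (abs_neg _).trans_le (abs_α_le hα _ _)
  simp only [mul_assoc]
  exact (l2Bdd_relay hA4 hh i j k).const_mul fun t => abs_α_le hα _ _

theorem l2Bdd_L (i j : Fin M) : L2Bdd P fun t ω => S.L t ω i j := by
  simp only [L, Matrix.of_apply]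
  split_ifs
  exacts [(L2Bdd.sum _ fun k _ => l2Bdd_lOff hA4 hα hh i k).neg, l2Bdd_lOff hA4 hα hh i j]

include hv in
theorem l2Bdd_vTot (i : Fin M) : L2Bdd P fun t ω => S.vTot t ω i := by
  simp only [vTot_eq]
  refine .add (.add (.sum_varying _ fun j => hv _ _) (.sum_varying _ fun p => hv _ _))
    (.sum_varying _ fun p => .sum_varying _ fun k => ?_)
  exact ((hh _ _).mul_of_indepFun (hv _ _) fun t => indepFun_fading_recv hA4 t _ _ _ _).const_mul
    fun t => abs_α_le hα _ _

variable [IsProbabilityMeasure P]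
include hb

theorem l2Bdd_γ (i : Fin M) : L2Bdd P fun t ω => S.γ t ω i := by
  simp only [γ_eq]
  refine .add (.add (.sum_varying _ fun j => ?_)
    (.sum_varying _ fun p => .sum_varying _ fun k => ?_))
    (.const (C := D) fun t => (abs_neg _).trans_le (hb t i))
  · exact (hh _ _).const_mul fun t => abs_α_le hα _ _
  · exact ((l2Bdd_relay hA4 hh i k p).const_mul fun t => abs_α_le hα _ _).const_mul
      fun t => abs_α_le hα _ _

theorem l2Bdd_Γ (i j : Fin M) : L2Bdd P fun t ω => S.Γ t ω i j := by
  simp only [Γ, Matrix.diagonal_apply]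
  split_ifs
  exacts [l2Bdd_γ hA4 hα hb hh i, .zero]

include hw hv in
theorem l2Bdd_noise : L2Bdd P S.noise := by
  refine .toLp fun i => ?_
  simp only [Δ, Pi.add_apply, Matrix.mulVec_diagonal, Pi.smul_apply, smul_eq_mul]
  exact (((hw i).const_mul (C := 1) fun t => by split_ifs <;> simp).add
    (l2Bdd_vTot hA4 hα hh hv i)).add
    ((l2Bdd_γ hA4 hα hb hh i).const_mul (c := fun _ => S.θ) fun _ => le_rfl)

theorem l2Bdd_Φ (i j : Fin M) : L2Bdd P fun t ω => S.Φ t ω i j := by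
  have hΔ : L2Bdd P fun t _ => S.Δ t i j := .const (C := 1) fun t => by
    simp only [Δ, Matrix.diagonal_apply]
    split_ifs <;> simp
  simp only [Φ, Matrix.sub_apply, Matrix.add_apply, sub_eq_add_neg]
  exact (hΔ.add (l2Bdd_L hA4 hα hh i j)).add (l2Bdd_Γ hA4 hα hb hh i j).neg

theorem l2Bdd_gain : L2Bdd P S.gain :=
  .toEuclideanCLM (l2Bdd_Φ hA4 hα hb hh)

variable (hΓ : ∀ t, meanMatrix P (S.Γ t) = 0)
include hΓ

theorem centered_γ (t : ℕ) (i : Fin M) : Centered P fun ω => S.γ t ω i :=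
  ⟨((l2Bdd_γ hA4 hα hb hh i).1 t).integrable one_le_two, by
    simpa [meanMatrix, Γ] using congrFun₂ (hΓ t) i i⟩

include hw hv in
open Classical in
theorem integral_noise (hw_mean : ∀ t i, ∫ ω, S.w t i ω ∂P = 0)
    (hv_mean : ∀ t i j, ∫ ω, S.v t i j ω ∂P = 0) (t : ℕ) : ∫ ω, S.noise t ω ∂P = 0 := by
  have hw (i : Fin M) : Centered P (S.w t i) :=
    ⟨((hw i).1 t).integrable one_le_two, hw_mean t i⟩
  have hv (j k : Node M R) : Centered P (S.v t j k) :=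
    ⟨((hv j k).1 t).integrable one_le_two, hv_mean t j k⟩
  have h_noise (i : Fin M) : Centered P fun ω => (S.noise t ω).ofLp i := by
    simp only [noise_apply, vTot_eq]
    refine .add (.add ((hw i).const_mul _) (.add (.add (.sum _ fun j _ => hv _ _)
      (.sum _ fun p _ => hv _ _)) (.sum _ fun p _ => .sum _ fun k _ => ?_)))
      ((centered_γ hA4 hα hb hh hΓ t i).const_mul _)
    exact (Centered.mul_of_indepFun (((hh _ _).1 t).integrable one_le_two) (hv _ _)
      (indepFun_fading_recv hA4 t _ _ _ _)).const_mul _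
  ext i
  rw [eval_integral_piLp fun i => (h_noise i).1, (h_noise i).2, PiLp.zero_apply]

theorem meanMatrix_Φ (t : ℕ) : meanMatrix P (S.Φ t) = S.Δ t + S.Lbar P t := by
  ext i j
  have hL : Integrable (fun ω => S.L t ω i j) P :=
    ((l2Bdd_L hA4 hα hh i j).1 t).integrable one_le_two
  have hΔL : Integrable (fun ω => S.Δ t i j + S.L t ω i j) P := (integrable_const _).add hL
  have hΓ_int : Integrable (fun ω => S.Γ t ω i j) P :=
    ((l2Bdd_Γ hA4 hα hb hh i j).1 t).integrable one_le_two
  have hΓ_mean : ∫ ω, S.Γ t ω i j ∂P = 0 := congrFun₂ (hΓ t) i j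
  simp only [meanMatrix, Lbar, Φ, Matrix.sub_apply, Matrix.add_apply, Matrix.of_apply]
  rw [integral_sub hΔL hΓ_int, integral_add (integrable_const _) hL, hΓ_mean, sub_zero,
    integral_const, probReal_univ, one_smul]

theorem integral_gain (t : ℕ) :
    ∫ ω, S.gain t ω ∂P = Matrix.toEuclideanCLM (𝕜 := ℝ) (S.Δ t + S.Lbar P t) := by
  rw [← meanMatrix_Φ hA4 hα hb hh hΓ t]
  exact integral_toEuclideanCLM fun i j =>
    ((l2Bdd_Φ hA4 hα hb hh i j).1 t).integrable one_le_two

include hw hv in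
theorem isLinearStochApprox (hx₀ : ∀ i, MemLp (fun ω => S.x₀ ω i) 2 P)
    (hw_mean : ∀ t i, ∫ ω, S.w t i ω ∂P = 0) (hv_mean : ∀ t i j, ∫ ω, S.v t i j ω ∂P = 0) :
    IsLinearStochApprox P S.a S.gain S.noise S.err where
  succ_eq := S.err_succ
  memLp_zero := memLp_piLp_iff.2 fun i => (hx₀ i).sub (memLp_const S.θ)
  indepFun_gain := indepFun_gain_err hA4
  indepFun_noise := indepFun_err_noise hA4
  l2Bdd_gain := l2Bdd_gain hA4 hα hb hh
  l2Bdd_noise := l2Bdd_noise hA4 hα hb hw hh hv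
  integral_noise := integral_noise hA4 hα hb hw hh hv hΓ hw_mean hv_mean

end Moments

section Drift

open scoped RealInnerProductSpace
open Matrix (toEuclideanCLM)

variable {M R : ℕ} {Ω : Type*} [MeasurableSpace Ω] (S : RelaySystem M R Ω) (P : Measure Ω)

theorem transpose_Δ (t : ℕ) : (S.Δ t).transpose = S.Δ t :=
  Matrix.diagonal_transpose _

theorem isHermitian_J (τ k : ℕ) : (S.J P τ k).IsHermitian := by
  rw [Matrix.IsHermitian, Matrix.conjTranspose_eq_transpose_of_trivial, J, Matrix.transpose_sum]
  refine Finset.sum_congr rfl fun s _ => ?_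
  rw [Matrix.transpose_smul, Matrix.transpose_add, Matrix.transpose_add, Matrix.transpose_smul,
    Matrix.transpose_transpose, transpose_Δ, add_right_comm]

theorem inner_toEuclideanCLM_J (τ k : ℕ) (x : EuclideanSpace ℝ (Fin M)) :
    ⟪x, toEuclideanCLM (𝕜 := ℝ) (S.J P τ k) x⟫ = ∑ s ∈ Finset.Ico (k * τ) ((k + 1) * τ),
      S.a s * (2 * ⟪x, toEuclideanCLM (𝕜 := ℝ) (S.Δ s + S.Lbar P s) x⟫) := by
  simp only [J, map_sum, map_add, map_smul, _root_.sum_apply, _root_.smul_apply,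
    _root_.add_apply, inner_sum, inner_add_right, real_inner_smul_right,
    inner_toEuclideanCLM_transpose]
  refine Finset.sum_congr rfl fun s _ => ?_
  ring

end Drift

end RelaySystem

theorem theorem2_general {M R : ℕ} {Ω : Type*} [MeasurableSpace Ω] (P : Measure Ω)
    [IsProbabilityMeasure P] (S : RelaySystem M R Ω) {τ : ℕ} (hτ : 0 < τ)
    (hx₀ : ∀ i, MemLp (fun ω => S.x₀ ω i) 2 P)
    (hα : ∃ C : ℝ, ∀ t i, S.α t i ≤ C) (hb : ∃ C : ℝ, ∀ t i, |S.b t i| ≤ C)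
    (hΓ : ∀ t, meanMatrix P (S.Γ t) = 0)
    (ha_anti : ∀ᶠ t in atTop, S.a (t + 1) ≤ S.a t) (ha_sum : ¬ Summable S.a)
    (ha_sq : Summable fun t => S.a t ^ 2)
    (hJ : ∃ c : ℝ, 0 < c ∧ ∀ᶠ k in atTop, c * S.a (k * τ) ≤ minEigenvalue (S.J P τ k))
    (hw : ∀ i, L2Bdd P fun t => S.w t i) (hw_mean : ∀ t i, ∫ ω, S.w t i ω ∂P = 0)
    (hh : ∀ i j, L2Bdd P fun t => S.h t i j)
    (hv : ∀ i j, L2Bdd P fun t => S.v t i j) (hv_mean : ∀ t i j, ∫ ω, S.v t i j ω ∂P = 0)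
    (hA4 : S.Assumption4 P) :
    (∀ t, Integrable (fun ω => ‖WithLp.toLp 2 (fun i => S.x t ω i - S.θ)‖ ^ 2) P) ∧
      Tendsto (fun t => ∫ ω, ‖WithLp.toLp 2 (fun i => S.x t ω i - S.θ)‖ ^ 2 ∂P)
        atTop (𝓝 0) := by
  obtain ⟨C, hα⟩ := hα
  obtain ⟨D, hb⟩ := hb
  obtain ⟨c, hc, hJ⟩ := hJ
  have h_rec := RelaySystem.isLinearStochApprox hA4 hα hb hw hh hv hΓ hx₀ hw_mean hv_mean
  refine ⟨fun t => (h_rec.memLp t).integrable_norm_pow two_ne_zero,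
    h_rec.tendsto_integral_norm_sq hτ (fun t => (S.a_pos t).le) ha_anti ha_sum ha_sq hc ?_⟩
  filter_upwards [hJ] with k hk x
  simp only [RelaySystem.integral_gain hA4 hα hb hh hΓ]
  rw [← S.inner_toEuclideanCLM_J P]
  exact (mul_le_mul_of_nonneg_right hk (sq_nonneg _)).trans
    (minEigenvalue_mul_norm_sq_le (S.isHermitian_J P τ k) x)

theorem theorem2 {M R : ℕ} {Ω : Type*} [MeasurableSpace Ω] (P : Measure Ω)
    [IsProbabilityMeasure P] (S : RelaySystem M R Ω) (B T : ℕ)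
    (hx₀ : ∀ i, MemLp (fun ω => S.x₀ ω i) 2 P)
    (hα : ∃ C : ℝ, ∀ t i, S.α t i ≤ C)
    (hb : ∃ C : ℝ, ∀ t i, |S.b t i| ≤ C)
    (hΓ : ∀ t, meanMatrix P (S.Γ t) = 0)
    (ha_decay : SlowDecay S.a)
    (ha_sums : PersistentSums S.a)
    (ha_sq : Summable fun t => S.a t ^ 2)
    (hJ : ∃ c : ℝ, 0 < c ∧ ∀ k : ℕ,
      c * S.a (k * max T B) ≤ minEigenvalue (S.J P (max T B) k))
    (hA1 : S.Assumption1 P B) (hA2 : S.Assumption2 P T)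
    (hA3 : S.Assumption3 P) (hA4 : S.Assumption4 P) :
    (∀ t, Integrable (fun ω => ‖WithLp.toLp 2 (fun i => S.x t ω i - S.θ)‖ ^ 2) P) ∧
      Tendsto (fun t => ∫ ω, ‖WithLp.toLp 2 (fun i => S.x t ω i - S.θ)‖ ^ 2 ∂P)
        atTop (𝓝 0) := by
  exact theorem2_general P S (lt_max_of_lt_left hA2.T_pos) hx₀ hα hb hΓ
    (ha_decay.eventually_succ_le S.a_pos) ha_sums.not_summable ha_sq
    (hJ.imp fun _ h => ⟨h.1, .of_forall h.2⟩) (RelaySystem.l2Bdd_w hA2) hA2.mean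
    (RelaySystem.l2Bdd_h hA3) (RelaySystem.l2Bdd_v hA3) hA3.mean_v hA4
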